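/- Setting. Let $\Omega\subset\mathbb R^d$ be a nonempty compact convex set of (Euclidean) diameter $D$, let $n\ge 1$, and let $f=\frac1n\sum_{i=1}^n f_i$, where every $f_i:\mathbb R^d\to\mathbb R$ is differentiable, convex and $L$-smooth: for all $w,v\in\mathbb R^d$, $$\nabla f_i(v)^\top(w-v)\le f_i(w)-f_i(v)\le \nabla f_i(v)^\top(w-v)+\tfrac L2\|w-v\|^2 .$$ Let $w^*\in\arg\min_{w\in\Omega} f(w)$. A linear optimization returns, for a given $c\in\mathbb R^d$, a point of $\arg\min_{v\in\Omega}c^\top v$. Algorithm (STORC), with parameters $\gamma_k,\beta_k,\eta_{t,k},m_{t,k},N_t$. Start from $w_0\in\arg\min_{w\in\Omega}\nabla f(x)^\top w$ for an arbitrary $x\in\Omega$. For $t=1,2,\dots,T$: put $x_0=y_0=w_{t-1}$ and compute $\nabla f(y_0)$; for $k=1,\dots,N_t$, put $z_k=(1-\gamma_k)y_{k-1}+\gamma_kx_{k-1}$; let $\tilde\nabla_k$ be the average of $m_{t,k}$ samples of $\nabla f_i(z_k)-(\nabla f_i(y_0)-\nabla f(y_0))$, with independent indices $i$ uniform on $\{1,\dots,n\}$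 (two stochastic gradients per sample); let $x_k$ be the output of the Frank–Wolfe method applied to $g(x)=\frac{\beta_k}2\|x-x_{k-1}\|^2+\tilde\nabla_k^\top x$ on $\Omega$, that is $u_0=x_{k-1}$, $u_j=(1-\frac2{j+1})u_{j-1}+\frac2{j+1}v_j$ with $v_j\in\arg\min_{v\in\Omega}\nabla g(u_{j-1})^\top v$, stopped at the first $u_j$ whose duality gap $\max_{u\in\Omega}\nabla g(u_j)^\top(u_j-u)$ is at most $\eta_{t,k}$ (one linear optimization at each of $u_0,\dots,u_j$); put $y_k=(1-\gamma_k)y_{k-1}+\gamma_kx_k$. Finally put $w_t=y_{N_t}$. Parameters. $\gamma_k=\frac2{k+1}$, $\beta_k=\frac{3L}k$, $\eta_{t,k}=\frac{2LD_t^2}{N_tk}$, and one of the following three cases: - (a) $\nabla f(w^*)=0$; $D_t=D$, $N_t=\lceil 2^{t/2+2}\rceil$, $m_{t,k}=900N_t$. - (b) $\|\nabla f(w)\|\le G$ for all $w\in\Omega$; $D_t=D$, $N_t=\lceil 2^{t/2+2}\rceil$, $m_{t,k}=\big\lceil 700N_t+\frac{24N_tG(k+1)}{LD}\big\rceil$.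 - (c) $f$ is $\alpha$-strongly convex on $\Omega$ with $\alpha>0$, i.e. $f(w)-f(v)\le\nabla f(w)^\top(w-v)-\frac\alpha2\|w-v\|^2$ for all $w,v\in\Omega$; $\mu=\frac L\alpha$, $D_t^2=\frac{\mu D^2}{2^{t-1}}$, $N_t=\lceil\sqrt{32\mu}\rceil$, $m_{t,k}=\lceil 5600N_t\mu\rceil$. Claim. There is an absolute constant $C>0$ such that for all $L$, $D$ and all $0<\epsilon\le\frac{LD^2}2$ there is a number $T$ of outer iterations, depending only on $L,D,\epsilon$, such that in each of the three cases the output satisfies $w_T\in\Omega$ and $\mathbb E[f(w_T)-f(w^*)]\le\epsilon$, while for every outcome of the samples the algorithm uses in total at most - $C\ln\frac{LD^2}\epsilon$ exact gradient evaluations; - $C\frac{LD^2}\epsilon$ linear optimizations (in case (c): for $\epsilon\le\alpha D^2$; for every $0<\epsilon\le\frac{LD^2}2$ the number in case (c) is at most $C\big(\frac{LD^2}\epsilon+\sqrt\mu\,\ln\frac{LD^2}\epsilon\big)$); - $C\frac{LD^2}\epsilon$ in case (a), $C\Big(\frac{LD^2}\epsilon+\frac{\sqrt L\,D^2G}{\epsilon^{1.5}}\Big)$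 in case (b), and $C\mu^2\ln\frac{LD^2}\epsilon$ in case (c), stochastic gradient evaluations. -/

import Mathlib

open MeasureTheory ProbabilityTheory
open scoped ENNReal

noncomputable section

namespace STORC

/-- The ambient space `ℝ^d` with its Euclidean structure. -/
abbrev Vec (d : ℕ) : Type := EuclideanSpace ℝ (Fin d)

/-- The objective `f = (1/n) ∑ i, f_i`. -/
def avg {d n : ℕ} (F : Fin n → Vec d → ℝ) (w : Vec d) : ℝ :=
  (1 / (n : ℝ)) * ∑ i, F i w

/-- `φ` is (differentiable,) convex and `L`-smooth on the whole of `ℝ^d`. -/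
structure ConvexSmooth {d : ℕ} (L : ℝ) (φ : Vec d → ℝ) : Prop where
  differentiable : Differentiable ℝ φ
  lower : ∀ w v : Vec d, inner ℝ (gradient φ v) (w - v) ≤ φ w - φ v
  upper : ∀ w v : Vec d,
    φ w - φ v ≤ inner ℝ (gradient φ v) (w - v) + L / 2 * ‖w - v‖ ^ 2

/-- `φ` is `G`-Lipschitz on `K`, in the sense that its gradient is bounded by `G` there. -/
def GradBoundedOn {d : ℕ} (G : ℝ) (K : Set (Vec d)) (φ : Vec d → ℝ) : Prop :=
  ∀ w ∈ K, ‖gradient φ w‖ ≤ G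

/-- `φ` is `α`-strongly convex on `K`. -/
def StronglyConvexOn {d : ℕ} (α : ℝ) (K : Set (Vec d)) (φ : Vec d → ℝ) : Prop :=
  ∀ w ∈ K, ∀ v ∈ K,
    φ w - φ v ≤ inner ℝ (gradient φ w) (w - v) - α / 2 * ‖w - v‖ ^ 2

/-- `lmo` is a linear optimization oracle for `K`: `lmo c ∈ argmin_{v ∈ K} cᵀ v`. -/
def IsLMO {d : ℕ} (K : Set (Vec d)) (lmo : Vec d → Vec d) : Prop :=
  ∀ c : Vec d, lmo c ∈ K ∧ ∀ v ∈ K, (inner ℝ c (lmo c) : ℝ) ≤ inner ℝ c v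

/-! ### The Frank-Wolfe subroutine -/

/-- Iterates `u_0, u_1, …` of standard Frank-Wolfe on `g`:
`u_j = (1 - 2/(j+1)) u_{j-1} + 2/(j+1) v_j` with `v_j ∈ argmin_{v ∈ K} ∇g(u_{j-1})ᵀ v`. -/
def fwIter {d : ℕ} (lmo : Vec d → Vec d) (g : Vec d → ℝ) (u₀ : Vec d) : ℕ → Vec d
  | 0 => u₀
  | j + 1 =>
    let u := fwIter lmo g u₀ j
    let γ : ℝ := 2 / (((j + 1 : ℕ) : ℝ) + 1)
    (1 - γ) • u + γ • lmo (gradient g u)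

/-- The duality gap of `g` at `u` over `K` is at most `η`. -/
def GapLE {d : ℕ} (K : Set (Vec d)) (g : Vec d → ℝ) (η : ℝ) (u : Vec d) : Prop :=
  ∀ x ∈ K, inner ℝ (gradient g u) (u - x) ≤ η

/-- The first index at which the duality gap is at most `η` (`⊤` if there is none). -/
def fwStop {d : ℕ} (K : Set (Vec d)) (lmo : Vec d → Vec d) (g : Vec d → ℝ) (η : ℝ)
    (u₀ : Vec d) : ℕ∞ :=
  sInf {N : ℕ∞ | ∃ j : ℕ, GapLE K g η (fwIter lmo g u₀ j) ∧ N = (j : ℕ∞)}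

/-- The iterate returned by Frank-Wolfe stopped at duality gap at most `η`. -/
def fwOut {d : ℕ} (K : Set (Vec d)) (lmo : Vec d → Vec d) (g : Vec d → ℝ) (η : ℝ)
    (u₀ : Vec d) : Vec d :=
  fwIter lmo g u₀ (fwStop K lmo g η u₀).toNat

/-- The number of linear optimizations made: one at each of `u_0, …, u_J`, where `J` is the
stopping index (the one at `u_j` both gives the duality gap there and the next direction).
It is `⊤` if the loop does not terminate. -/
def fwCost {d : ℕ} (K : Set (Vec d)) (lmo : Vec d → Vec d) (g : Vec d → ℝ) (η : ℝ)
    (u₀ : Vec d) : ℕ∞ :=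
  fwStop K lmo g η u₀ + 1

/-! ### The algorithm -/

/-- The parameters `γ_k, β_k, η_{t,k}, m_{t,k}, N_t` of the algorithm. -/
structure Params where
  γ : ℕ → ℝ
  β : ℕ → ℝ
  η : ℕ → ℕ → ℝ
  m : ℕ → ℕ → ℕ
  N : ℕ → ℕ

/-- State of the inner loop: the points `x_k`, `y_k`, and the numbers of stochastic gradients
and of linear optimizations used so far. -/
structure Inner (d : ℕ) where
  x : Vec d
  y : Vec d
  stoch : ℕ
  lin : ℕ∞

/-- State of the outer loop: the point `w_t`, and the numbers of exact gradients, stochastic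
gradients and linear optimizations used so far. -/
structure Outer (d : ℕ) where
  w : Vec d
  exact : ℕ
  stoch : ℕ
  lin : ℕ∞

/-- The variance-reduced stochastic gradient `∇f_i(z) - (∇f_i(y₀) - g₀)`, `g₀ = ∇f(y₀)`. -/
def vrGrad {d n : ℕ} (F : Fin n → Vec d → ℝ) (y₀ g₀ z : Vec d) (i : Fin n) : Vec d :=
  gradient (F i) z - (gradient (F i) y₀ - g₀)

/-- The average of `m` variance-reduced stochastic gradients, with samples `ζ 0, …, ζ (m-1)`. -/
def batch {d n : ℕ} (F : Fin n → Vec d → ℝ) (y₀ g₀ z : Vec d) (m : ℕ) (ζ : ℕ → Fin n) : Vec d :=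
  (1 / (m : ℝ)) • ∑ j ∈ Finset.range m, vrGrad F y₀ g₀ z (ζ j)

/-- The objective of the subproblem, `g(x) = (β/2) ‖x - x_{k-1}‖² + ∇̃ᵀ x`. -/
def subObj {d : ℕ} (β : ℝ) (xprev grad : Vec d) (x : Vec d) : ℝ :=
  β / 2 * ‖x - xprev‖ ^ 2 + inner ℝ grad x

/-- Inner iteration `k` of outer iteration `t`. Every variance-reduced stochastic gradient takes
two stochastic gradient evaluations. Frank-Wolfe is started at `x_{k-1}`. -/
def innerStep {d n : ℕ} (p : Params) (K : Set (Vec d)) (F : Fin n → Vec d → ℝ)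
    (lmo : Vec d → Vec d) (t : ℕ) (y₀ g₀ : Vec d) (k : ℕ) (ζ : ℕ → Fin n) (s : Inner d) :
    Inner d :=
  let z := (1 - p.γ k) • s.y + p.γ k • s.x
  let gr := batch F y₀ g₀ z (p.m t k) ζ
  let g := subObj (p.β k) s.x gr
  let x' := fwOut K lmo g (p.η t k) s.x
  { x := x'
    y := (1 - p.γ k) • s.y + p.γ k • x'
    stoch := s.stoch + 2 * p.m t k
    lin := s.lin + fwCost K lmo g (p.η t k) s.x }

/-- The inner loop of outer iteration `t`, after `k` iterations, from the snapshot `y₀`;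
`ξ k j` is the `j`-th index sampled in iteration `k`. -/
def innerLoop {d n : ℕ} (p : Params) (K : Set (Vec d)) (F : Fin n → Vec d → ℝ)
    (lmo : Vec d → Vec d) (t : ℕ) (y₀ g₀ : Vec d) (ξ : ℕ → ℕ → Fin n) : ℕ → Inner d
  | 0 => { x := y₀, y := y₀, stoch := 0, lin := 0 }
  | k + 1 => innerStep p K F lmo t y₀ g₀ (k + 1) (ξ (k + 1))
      (innerLoop p K F lmo t y₀ g₀ ξ k)

/-- STORC after `t` outer iterations, initialized from `x₀`; `ξ t k j` is the `j`-th index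
sampled in inner iteration `k` of outer iteration `t`. -/
def run {d n : ℕ} (p : Params) (K : Set (Vec d)) (F : Fin n → Vec d → ℝ)
    (lmo : Vec d → Vec d) (x₀ : Vec d) (ξ : ℕ → ℕ → ℕ → Fin n) : ℕ → Outer d
  | 0 => { w := lmo (gradient (avg F) x₀), exact := 1, stoch := 0, lin := 1 }
  | t + 1 =>
    let s := run p K F lmo x₀ ξ t
    let r := innerLoop p K F lmo (t + 1) s.w (gradient (avg F) s.w) (ξ (t + 1)) (p.N (t + 1))
    { w := r.y
      exact := s.exact + 1
      stoch := s.stoch + r.stoch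
      lin := s.lin + r.lin }

/-! ### The three choices of parameters -/

/-- `γ_k = 2/(k+1)`, `β_k = 3L/k`, `η_{t,k} = 2 L D_t² / (N_t k)`; `Dsq t` is `D_t²`. -/
def mkParams (L : ℝ) (Dsq : ℕ → ℝ) (N : ℕ → ℕ) (m : ℕ → ℕ → ℕ) : Params where
  γ k := 2 / ((k : ℝ) + 1)
  β k := 3 * L / (k : ℝ)
  η t k := 2 * L * Dsq t / ((N t : ℝ) * (k : ℝ))
  m := m
  N := N

/-- `N_t = ⌈2^{t/2+2}⌉`. -/
def growingN (t : ℕ) : ℕ := ⌈(2 : ℝ) ^ ((t : ℝ) / 2 + 2)⌉₊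

/-- Case (a): `D_t = D`, `N_t = ⌈2^{t/2+2}⌉`, `m_{t,k} = 900 N_t`. -/
def paramsA (L D : ℝ) : Params :=
  mkParams L (fun _ => D ^ 2) growingN (fun t _ => 900 * growingN t)

/-- Case (b): `D_t = D`, `N_t = ⌈2^{t/2+2}⌉`, `m_{t,k} = ⌈700 N_t + 24 N_t G (k+1) / (L D)⌉`. -/
def paramsB (L D G : ℝ) : Params :=
  mkParams L (fun _ => D ^ 2) growingN
    (fun t k => ⌈700 * (growingN t : ℝ)
      + 24 * (growingN t : ℝ) * G * ((k : ℝ) + 1) / (L * D)⌉₊)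

/-- Case (c): `D_t² = μ D² / 2^{t-1}`, `N_t = ⌈√(32 μ)⌉`, `m_{t,k} = ⌈5600 N_t μ⌉`. -/
def paramsC (L D μ : ℝ) : Params :=
  mkParams L (fun t => μ * D ^ 2 / (2 : ℝ) ^ ((t : ℤ) - 1)) (fun _ => ⌈√(32 * μ)⌉₊)
    (fun _ _ => ⌈5600 * (⌈√(32 * μ)⌉₊ : ℝ) * μ⌉₊)

/-! ### Randomness and accuracy -/

/-- The samples are independent and uniform on `{1, …, n}`. -/
structure UniformSamples {S : Type*} [MeasurableSpace S] (P : Measure S) {n : ℕ}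
    (ξ : ℕ × ℕ × ℕ → S → Fin n) : Prop where
  measurable : ∀ a, Measurable (ξ a)
  uniform : ∀ a i, P {ω | ξ a ω = i} = (n : ℝ≥0∞)⁻¹
  indep : iIndepFun ξ P

/-- The run of STORC driven by the random samples `ξ`, at the outcome `ω`. -/
def randomRun {S : Type*} {d n : ℕ} (p : Params) (K : Set (Vec d)) (F : Fin n → Vec d → ℝ)
    (lmo : Vec d → Vec d) (x₀ : Vec d) (ξ : ℕ × ℕ × ℕ → S → Fin n) (T : ℕ) (ω : S) : Outer d :=
  run p K F lmo x₀ (fun t k j => ξ (t, k, j) ω) T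

/-- The random point `w` lies in `K` and `E[φ(w) - φ(w⋆)] ≤ ε`. -/
def Accurate {S : Type*} [MeasurableSpace S] (P : Measure S) {d : ℕ} (K : Set (Vec d))
    (φ : Vec d → ℝ) (wstar : Vec d) (ε : ℝ) (w : S → Vec d) : Prop :=
  (∀ ω, w ω ∈ K) ∧ Integrable (fun ω => φ (w ω) - φ wstar) P ∧
    ∫ ω, (φ (w ω) - φ wstar) ∂P ≤ ε

/-- The run `r` outputs a point of expected accuracy `ε` while using, for every outcome of the
samples, at most `a` exact gradients, `b` linear optimizations and `c` stochastic gradients. -/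
def Achieves {S : Type*} [MeasurableSpace S] (P : Measure S) {d : ℕ} (K : Set (Vec d))
    (φ : Vec d → ℝ) (wstar : Vec d) (ε : ℝ) (r : S → Outer d) (a b c : ℝ) : Prop :=
  Accurate P K φ wstar ε (fun ω => (r ω).w) ∧
    ∀ ω, ((r ω).exact : ℝ) ≤ a ∧ ((r ω).lin : ℝ≥0∞) ≤ ENNReal.ofReal b ∧ ((r ω).stoch : ℝ) ≤ c

end STORC

end

/-! Everything follows from one invariant: after `t` rounds the expected gap of `w_t` is at most `L
D² / 2^(t+1)` (`Problem.mean_gap_le`). Hence `T = ⌈log₂ (L D² / ε)⌉` rounds suffice, and the costs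
are sums over rounds.

Within a round the potential is `Φ_k = k(k+1)(f(y_k) - f(w*)) + 3L‖x_k - w*‖²`. By
`ConvexSmooth.step_le`, iteration `k` raises it by at most `2kη_k = 4L D_t²/N_t`, plus `k²/L` times
the squared gradient error, plus an inner product of mean zero. The batch size keeps the expected
variance term below `L D_t²/N_t`. As `E‖w_{t-1} - w*‖² ≤ D_t²`, the expected potential stays below
`(3 + 5) L D_t²`, so the new expected gap is at most `8L D_t²/N_t²`; `N_t` is chosen to make this
half of the previous bound.

The variance is the delicate point. Co-coercivity and first-order optimality of `w*` on `K` bound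
the mean squared error of one sample by `3(L²‖z-y‖² + 2L gap(y) + 2L gap(y₀))`
(`avg_norm_vrErr_sq_le`). The potential of the preceding iteration controls `gap(y)`, the previous
round controls `gap(y₀)`, and `‖z-y‖` is controlled by the diameter in cases (a), (b) and by strong
convexity together with the potential in case (c).

Frank-Wolfe reaches duality gap `η` in about `6βD²/η = 9N_t D²/D_t²` steps, whatever `k`
(`exists_gapLE`). A round thus costs `O(N_t² D²/D_t² + N_t)` linear optimizations, which is `O(2^t)`
in (a), (b) and `O(2^t + √μ)` in (c).

The state depends on finitely many samples with values in a finite set, so integrability is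
automatic, and conditional expectations reduce to replacing one sample by a fresh uniform one
(`mean_resample`). -/

namespace STORC

/-! ### Smooth convex functions, gradient variance and the accelerated step -/

section ConvexAnalysis

variable {d n : ℕ} {L : ℝ}

/-- A convex `L`-smooth function satisfies the quantitative co-coercivity inequality. -/
theorem ConvexSmooth.norm_gradient_sub_sq_le {φ : Vec d → ℝ} (h : ConvexSmooth L φ) (hL : 0 < L)
    (w v : Vec d) :
    ‖gradient φ w - gradient φ v‖ ^ 2
      ≤ 2 * L * (φ w - φ v - inner ℝ (gradient φ v) (w - v)) := by
  set g := gradient φ w - gradient φ v with hg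
  -- The test point `w - g/L` minimizes the quadratic upper model at `w` of `φ - ⟨∇φ(v), ·⟩`.
  have h1 := h.lower (w - (1 / L) • g) v
  have h2 := h.upper (w - (1 / L) • g) w
  have e1 : w - (1 / L) • g - v = (w - v) - (1 / L) • g := by abel
  have e2 : w - (1 / L) • g - w = - ((1 / L) • g) := by abel
  rw [e1, inner_sub_right, inner_smul_right] at h1
  rw [e2, inner_neg_right, inner_smul_right, norm_neg, norm_smul, Real.norm_eq_abs, mul_pow,
    sq_abs] at h2
  have h3 : inner ℝ (gradient φ w) g - inner ℝ (gradient φ v) g = ‖g‖ ^ 2 := by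
    rw [← inner_sub_left, ← hg, real_inner_self_eq_norm_sq]
  have h4 : L / 2 * ((1 / L) ^ 2 * ‖g‖ ^ 2) = (1 / (2 * L)) * ‖g‖ ^ 2 := by field_simp
  rw [h4] at h2
  have h5 : (1 / L) * inner ℝ (gradient φ w) g - (1 / L) * inner ℝ (gradient φ v) g
      = 2 * ((1 / (2 * L)) * ‖g‖ ^ 2) := by
    rw [← mul_sub, h3]; field_simp
  have h6 : (1 / (2 * L)) * ‖g‖ ^ 2 ≤ φ w - φ v - inner ℝ (gradient φ v) (w - v) := by linarith
  calc ‖g‖ ^ 2 = 2 * L * ((1 / (2 * L)) * ‖g‖ ^ 2) := by field_simp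
    _ ≤ _ := by gcongr

theorem ConvexSmooth.norm_gradient_sub_sq_le_norm {φ : Vec d → ℝ} (h : ConvexSmooth L φ)
    (hL : 0 < L) (w v : Vec d) :
    ‖gradient φ w - gradient φ v‖ ^ 2 ≤ L ^ 2 * ‖w - v‖ ^ 2 := by
  have h1 := h.norm_gradient_sub_sq_le hL w v
  have h2 := h.upper w v
  have h3 : 2 * L * (φ w - φ v - inner ℝ (gradient φ v) (w - v))
      ≤ 2 * L * (L / 2 * ‖w - v‖ ^ 2) := by gcongr; linarith
  linarith

theorem gradient_avg {F : Fin n → Vec d → ℝ} (hF : ∀ i, Differentiable ℝ (F i)) (w : Vec d) :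
    gradient (avg F) w = (1 / (n : ℝ)) • ∑ i, gradient (F i) w := by
  apply HasGradientAt.gradient
  rw [hasGradientAt_iff_hasFDerivAt, map_smul, map_sum]
  have h : HasFDerivAt (fun w => ∑ i, F i w)
      (∑ i, (InnerProductSpace.toDual ℝ (Vec d)) (gradient (F i) w)) w :=
    HasFDerivAt.fun_sum fun i _ => ((hF i) w).hasGradientAt.hasFDerivAt
  exact h.const_mul (1 / (n : ℝ))

theorem avg_convexSmooth (hn : 0 < n) {F : Fin n → Vec d → ℝ} (hF : ∀ i, ConvexSmooth L (F i)) :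
    ConvexSmooth L (avg F) := by
  have hn' : (0 : ℝ) < n := by exact_mod_cast hn
  have hdiff := fun i => (hF i).differentiable
  have key : ∀ w v : Vec d, inner ℝ (gradient (avg F) v) (w - v)
      = (1 / (n : ℝ)) * ∑ i, inner ℝ (gradient (F i) v) (w - v) := fun w v => by
    rw [gradient_avg hdiff, real_inner_smul_left, sum_inner]
  have key2 : ∀ w v : Vec d, avg F w - avg F v = (1 / (n : ℝ)) * ∑ i, (F i w - F i v) :=
    fun w v => by rw [avg, avg, ← mul_sub, Finset.sum_sub_distrib]
  refine ⟨?_, fun w v => ?_, fun w v => ?_⟩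
  · unfold avg
    exact (Differentiable.fun_sum fun i _ => hdiff i).const_mul _
  · rw [key, key2]
    gcongr with i
    exact (hF i).lower w v
  · rw [key, key2]
    have : (1 / (n : ℝ)) * ∑ i : Fin n, (F i w - F i v)
        ≤ (1 / (n : ℝ)) * ∑ i, (inner ℝ (gradient (F i) v) (w - v) + L / 2 * ‖w - v‖ ^ 2) := by
      gcongr with i
      exact (hF i).upper w v
    refine this.trans (le_of_eq ?_)
    rw [Finset.sum_add_distrib, mul_add, Finset.sum_const, Finset.card_univ, Fintype.card_fin,
      nsmul_eq_mul]
    field_simp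

/-- First-order optimality for a constrained minimizer of a smooth function. -/
theorem ConvexSmooth.inner_gradient_nonneg_of_isMinOn {φ : Vec d → ℝ} (h : ConvexSmooth L φ)
    {K : Set (Vec d)} (hK : Convex ℝ K) {ws w : Vec d} (hws : ws ∈ K) (hmin : IsMinOn φ K ws)
    (hw : w ∈ K) : 0 ≤ inner ℝ (gradient φ ws) (w - ws) := by
  set c : ℝ := inner ℝ (gradient φ ws) (w - ws)
  -- Move a fraction `s` towards `w`, divide the increase of `φ` by `s`, then let `s → 0`.
  have hstep : ∀ s : ℝ, 0 < s → s ≤ 1 → 0 ≤ c + s * (L / 2 * ‖w - ws‖ ^ 2) := fun s hs hs1 => by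
    have hmem : ws + s • (w - ws) ∈ K := hK.add_smul_sub_mem hws hw ⟨hs.le, hs1⟩
    have h1 := h.upper (ws + s • (w - ws)) ws
    have h2 : φ ws ≤ φ (ws + s • (w - ws)) := hmin hmem
    rw [add_sub_cancel_left, inner_smul_right, norm_smul, mul_pow, Real.norm_eq_abs, sq_abs] at h1
    have h3 : 0 ≤ s * (c + s * (L / 2 * ‖w - ws‖ ^ 2)) := by
      have : s * (c + s * (L / 2 * ‖w - ws‖ ^ 2)) = s * c + L / 2 * (s ^ 2 * ‖w - ws‖ ^ 2) := by
        ring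
      linarith
    exact nonneg_of_mul_nonneg_right h3 hs
  have hlim : Filter.Tendsto (fun s : ℝ => c + s * (L / 2 * ‖w - ws‖ ^ 2))
      (nhdsWithin 0 (Set.Ioi 0)) (nhds c) := by
    have : ContinuousAt (fun s : ℝ => c + s * (L / 2 * ‖w - ws‖ ^ 2)) 0 := by fun_prop
    have h0 := this.tendsto
    simp only [zero_mul, add_zero] at h0
    exact h0.mono_left nhdsWithin_le_nhds
  refine ge_of_tendsto hlim ?_
  filter_upwards [Ioc_mem_nhdsGT (zero_lt_one (α := ℝ))] with s hs using hstep s hs.1 hs.2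

theorem norm_add_three_sq_le (a b c : Vec d) :
    ‖a + b + c‖ ^ 2 ≤ 3 * (‖a‖ ^ 2 + ‖b‖ ^ 2 + ‖c‖ ^ 2) := by
  have h : ‖a + b + c‖ ≤ ‖a‖ + ‖b‖ + ‖c‖ := norm_add₃_le
  have h2 : ‖a + b + c‖ ^ 2 ≤ (‖a‖ + ‖b‖ + ‖c‖) ^ 2 := by gcongr
  nlinarith [sq_nonneg (‖a‖ - ‖b‖), sq_nonneg (‖a‖ - ‖c‖), sq_nonneg (‖b‖ - ‖c‖)]

/-- Subtracting the mean does not increase the second moment. -/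
theorem sum_norm_sub_mean_sq_le (hn : 0 < n) (a : Fin n → Vec d) :
    ∑ i, ‖a i - (1 / (n : ℝ)) • ∑ j, a j‖ ^ 2 ≤ ∑ i, ‖a i‖ ^ 2 := by
  have hn' : (0 : ℝ) < n := by exact_mod_cast hn
  set m := (1 / (n : ℝ)) • ∑ j, a j with hm
  have hs : ∑ j, a j = (n : ℝ) • m := by
    rw [hm, smul_smul, mul_one_div_cancel hn'.ne', one_smul]
  have : ∑ i, ‖a i - m‖ ^ 2 = ∑ i, ‖a i‖ ^ 2 - n * ‖m‖ ^ 2 := by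
    simp_rw [norm_sub_sq_real, Finset.sum_add_distrib, Finset.sum_sub_distrib, ← Finset.mul_sum,
      ← sum_inner, hs, real_inner_smul_left, real_inner_self_eq_norm_sq]
    simp; ring
  rw [this]
  have : 0 ≤ (n : ℝ) * ‖m‖ ^ 2 := by positivity
  linarith

/-- Mean squared distance of the component gradients to those at a constrained minimizer. -/
theorem avg_norm_gradient_sub_sq_le (hL : 0 < L) (hn : 0 < n) {F : Fin n → Vec d → ℝ}
    (hF : ∀ i, ConvexSmooth L (F i)) {K : Set (Vec d)} (hK : Convex ℝ K) {ws w : Vec d}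
    (hws : ws ∈ K) (hmin : IsMinOn (avg F) K ws) (hw : w ∈ K) :
    (1 / (n : ℝ)) * ∑ i, ‖gradient (F i) w - gradient (F i) ws‖ ^ 2
      ≤ 2 * L * (avg F w - avg F ws) := by
  have hopt := (avg_convexSmooth hn hF).inner_gradient_nonneg_of_isMinOn hK hws hmin hw
  have h1 : (1 / (n : ℝ)) * ∑ i, ‖gradient (F i) w - gradient (F i) ws‖ ^ 2
      ≤ (1 / (n : ℝ)) * ∑ i, 2 * L * (F i w - F i ws - inner ℝ (gradient (F i) ws) (w - ws)) := by
    gcongr with i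
    exact (hF i).norm_gradient_sub_sq_le hL w ws
  have h2 : (1 / (n : ℝ)) * ∑ i, 2 * L * (F i w - F i ws - inner ℝ (gradient (F i) ws) (w - ws))
      = 2 * L * (avg F w - avg F ws - inner ℝ (gradient (avg F) ws) (w - ws)) := by
    rw [gradient_avg fun i => (hF i).differentiable, real_inner_smul_left, sum_inner, avg, avg,
      ← Finset.mul_sum, Finset.sum_sub_distrib, Finset.sum_sub_distrib]
    ring
  rw [h2] at h1
  exact h1.trans (mul_le_mul_of_nonneg_left (by linarith) (by positivity))

/-- The error of a variance-reduced stochastic gradient. -/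
noncomputable def vrErr (F : Fin n → Vec d → ℝ) (y₀ z : Vec d) (i : Fin n) : Vec d :=
  gradient (avg F) z - vrGrad F y₀ (gradient (avg F) y₀) z i

theorem vrErr_self (F : Fin n → Vec d → ℝ) (y₀ : Vec d) (i : Fin n) : vrErr F y₀ y₀ i = 0 := by
  simp [vrErr, vrGrad]

theorem sum_vrErr (hn : 0 < n) {F : Fin n → Vec d → ℝ} (hF : ∀ i, Differentiable ℝ (F i))
    (y₀ z : Vec d) : ∑ i, vrErr F y₀ z i = 0 := by
  have hn' : (n : ℝ) ≠ 0 := by exact_mod_cast hn.ne'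
  have h : ∀ w, (n : ℝ) • gradient (avg F) w = ∑ i, gradient (F i) w := fun w => by
    rw [gradient_avg hF, smul_smul, mul_one_div_cancel hn', one_smul]
  simp only [vrErr, vrGrad, Finset.sum_sub_distrib, ← h, Finset.sum_const, Finset.card_univ,
    Fintype.card_fin, ← Nat.cast_smul_eq_nsmul ℝ]
  abel

/-- Centering does not increase the second moment, so only `∇f_i(z) - ∇f_i(y₀)` matters. It is split
through `y` and `w*` because the potential controls the gap at `y`, not at `z`. -/
theorem avg_norm_vrErr_sq_le (hL : 0 < L) (hn : 0 < n) {F : Fin n → Vec d → ℝ}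
    (hF : ∀ i, ConvexSmooth L (F i)) {K : Set (Vec d)} (hK : Convex ℝ K) {ws y₀ y : Vec d}
    (hws : ws ∈ K) (hmin : IsMinOn (avg F) K ws) (hy₀ : y₀ ∈ K) (hy : y ∈ K) (z : Vec d) :
    (1 / (n : ℝ)) * ∑ i, ‖vrErr F y₀ z i‖ ^ 2
      ≤ 3 * (L ^ 2 * ‖z - y‖ ^ 2 + 2 * L * (avg F y - avg F ws)
        + 2 * L * (avg F y₀ - avg F ws)) := by
  have hn' : (0 : ℝ) < n := by exact_mod_cast hn
  have hdiff := fun i => (hF i).differentiable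
  have h1 : ∑ i, ‖vrErr F y₀ z i‖ ^ 2 ≤ ∑ i, ‖gradient (F i) z - gradient (F i) y₀‖ ^ 2 := by
    refine le_trans (le_of_eq ?_)
      (sum_norm_sub_mean_sq_le hn fun i => gradient (F i) z - gradient (F i) y₀)
    refine Finset.sum_congr rfl fun i _ => ?_
    rw [Finset.sum_sub_distrib, smul_sub, ← gradient_avg hdiff, ← gradient_avg hdiff, ← norm_neg]
    congr 2
    simp only [vrErr, vrGrad]
    abel
  have h2 : ∀ i, ‖gradient (F i) z - gradient (F i) y₀‖ ^ 2
      ≤ 3 * (L ^ 2 * ‖z - y‖ ^ 2 + ‖gradient (F i) y - gradient (F i) ws‖ ^ 2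
        + ‖gradient (F i) y₀ - gradient (F i) ws‖ ^ 2) := fun i => by
    have e : gradient (F i) z - gradient (F i) y₀ = (gradient (F i) z - gradient (F i) y)
        + (gradient (F i) y - gradient (F i) ws) + (gradient (F i) ws - gradient (F i) y₀) := by
      abel
    rw [e, norm_sub_rev (gradient (F i) y₀)]
    refine (norm_add_three_sq_le _ _ _).trans ?_
    gcongr
    exact (hF i).norm_gradient_sub_sq_le_norm hL z y
  have h3 : (1 / (n : ℝ)) * ∑ i, ‖vrErr F y₀ z i‖ ^ 2 ≤ (1 / (n : ℝ)) * ∑ i : Fin n,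
      3 * (L ^ 2 * ‖z - y‖ ^ 2 + ‖gradient (F i) y - gradient (F i) ws‖ ^ 2
        + ‖gradient (F i) y₀ - gradient (F i) ws‖ ^ 2) :=
    mul_le_mul_of_nonneg_left (h1.trans (Finset.sum_le_sum fun i _ => h2 i)) (by positivity)
  refine h3.trans ?_
  rw [← Finset.mul_sum, Finset.sum_add_distrib, Finset.sum_add_distrib, Finset.sum_const,
    Finset.card_univ, Fintype.card_fin, nsmul_eq_mul]
  have h4 := avg_norm_gradient_sub_sq_le hL hn hF hK hws hmin hy
  have h5 := avg_norm_gradient_sub_sq_le hL hn hF hK hws hmin hy₀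
  have h6 : (1 / (n : ℝ)) * (n * (L ^ 2 * ‖z - y‖ ^ 2)) = L ^ 2 * ‖z - y‖ ^ 2 := by field_simp
  linarith

theorem hasGradientAt_subObj (β : ℝ) (xp g x : Vec d) :
    HasGradientAt (subObj β xp g) (β • (x - xp) + g) x := by
  rw [hasGradientAt_iff_hasFDerivAt]
  have h1 : HasFDerivAt (fun x : Vec d => x - xp) (ContinuousLinearMap.id ℝ (Vec d)) x :=
    (hasFDerivAt_id x).sub_const xp
  have h2 := (h1.norm_sq).const_mul (β / 2)
  have h3 : HasFDerivAt (fun x : Vec d => (inner ℝ g x : ℝ)) (innerSL ℝ g) x :=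
    (innerSL ℝ g).hasFDerivAt
  refine (h2.add h3).congr_fderiv ?_
  ext v
  simp
  ring

theorem gradient_subObj (β : ℝ) (xp g x : Vec d) :
    gradient (subObj β xp g) x = β • (x - xp) + g :=
  (hasGradientAt_subObj β xp g x).gradient

/-- Exact second-order expansion of the quadratic subproblem. -/
theorem subObj_sub (β : ℝ) (xp g x u : Vec d) :
    subObj β xp g x - subObj β xp g u
      = inner ℝ (gradient (subObj β xp g) u) (x - u) + β / 2 * ‖x - u‖ ^ 2 := by
  rw [gradient_subObj, subObj, subObj]
  have e : x - xp = (u - xp) + (x - u) := by abel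
  rw [e, norm_add_sq_real, inner_add_left, real_inner_smul_left, inner_sub_right g]
  ring

/-- One accelerated step with an inexact gradient and an approximately solved subproblem. -/
theorem ConvexSmooth.step_le {φ : Vec d → ℝ} (h : ConvexSmooth L φ) (hL : 0 < L)
    {k : ℕ} {η : ℝ} {ws x y x' g : Vec d} {z : Vec d}
    (hz : z = (1 - 2 / ((k + 1 : ℕ) + 1 : ℝ)) • y + (2 / ((k + 1 : ℕ) + 1 : ℝ)) • x)
    (hgap : inner ℝ (gradient (subObj (3 * L / (k + 1 : ℕ)) x g) x') (x' - ws) ≤ η) :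
    ((k : ℝ) + 1) * (k + 2)
        * (φ ((1 - 2 / ((k + 1 : ℕ) + 1 : ℝ)) • y + (2 / ((k + 1 : ℕ) + 1 : ℝ)) • x') - φ ws)
        + 3 * L * ‖x' - ws‖ ^ 2
      ≤ (k : ℝ) * (k + 1) * (φ y - φ ws) + 3 * L * ‖x - ws‖ ^ 2 + 2 * (k + 1) * η
        + (k + 1) ^ 2 / L * ‖gradient φ z - g‖ ^ 2
        + 2 * (k + 1) * inner ℝ (gradient φ z - g) (x - ws) := by
  push_cast at hz hgap ⊢
  set γ : ℝ := 2 / ((k : ℝ) + 1 + 1) with hγ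
  set y' := (1 - γ) • y + γ • x' with hy'
  have hk : (0 : ℝ) < k + 1 := by positivity
  have hγ0 : 0 < γ := by positivity
  have hγ1 : γ ≤ 1 := by rw [hγ, div_le_one (by positivity)]; linarith
  have h1 := h.upper y' z
  have h2 := h.lower y z
  have h3 := h.lower ws z
  set q := gradient φ z with hq
  set δ := q - g with hδ
  have e1 : y' - z = γ • (x' - x) := by rw [hy', hz]; module
  have e2 : y - z = γ • (y - x) := by rw [hz]; module
  have e3 : ws - z = (ws - x') + (x' - x) - (1 - γ) • (y - x) := by rw [hz]; module
  rw [e1, inner_smul_right, norm_smul, mul_pow, Real.norm_eq_abs, sq_abs] at h1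
  rw [e2, inner_smul_right] at h2
  rw [e3, inner_sub_right, inner_add_right, inner_smul_right] at h3
  have h4 : (1 - γ) * (γ * inner ℝ q (y - x)) ≤ (1 - γ) * (φ y - φ z) :=
    mul_le_mul_of_nonneg_left h2 (by linarith)
  have h5 := mul_le_mul_of_nonneg_left h3 hγ0.le
  have hmain : φ y' - φ ws ≤ (1 - γ) * (φ y - φ ws) + γ * inner ℝ q (x' - ws)
      + L / 2 * (γ ^ 2 * ‖x' - x‖ ^ 2) := by
    have : inner ℝ q (ws - x') = - inner ℝ q (x' - ws) := by rw [← inner_neg_right, neg_sub]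
    rw [this] at h5
    nlinarith
  rw [gradient_subObj, inner_add_left, real_inner_smul_left] at hgap
  have e4 : inner ℝ (x' - x) (x' - ws)
      = (1 / 2) * (‖x' - x‖ ^ 2 + ‖x' - ws‖ ^ 2 - ‖x - ws‖ ^ 2) := by
    have : x - ws = (x' - ws) - (x' - x) := by abel
    rw [this, norm_sub_sq_real (x' - ws) (x' - x), real_inner_comm (x' - ws) (x' - x)]; ring
  have e5 : inner ℝ q (x' - ws) = inner ℝ g (x' - ws) + inner ℝ δ (x - ws)
      + inner ℝ δ (x' - x) := by
    rw [add_assoc, ← inner_add_right, show x - ws + (x' - x) = x' - ws by abel, ← inner_add_left]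
    congr 1
    rw [hδ]; abel
  -- Young's inequality, weighted so that the `‖x' - x‖²` part costs exactly `L` after
  -- multiplication by `2(k+1)`.
  have h6 : inner ℝ δ (x' - x) ≤ (k + 1) / (2 * L) * ‖δ‖ ^ 2
      + L / (2 * (k + 1)) * ‖x' - x‖ ^ 2 := by
    have h7 : inner ℝ δ (x' - x) ≤ ‖δ‖ * ‖x' - x‖ := real_inner_le_norm _ _
    refine h7.trans ?_
    have h8 : 0 ≤ (1 / (2 * L * (k + 1))) * ((k + 1) * ‖δ‖ - L * ‖x' - x‖) ^ 2 := by positivity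
    have h9 : (1 / (2 * L * (k + 1))) * ((k + 1) * ‖δ‖ - L * ‖x' - x‖) ^ 2
      = (k + 1) / (2 * L) * ‖δ‖ ^ 2 + L / (2 * (k + 1)) * ‖x' - x‖ ^ 2 - ‖δ‖ * ‖x' - x‖ := by
      field_simp; ring
    linarith
  rw [e4] at hgap
  set A := ‖x' - x‖ ^ 2 with hA
  have hA0 : 0 ≤ A := by positivity
  have h10 : inner ℝ q (x' - ws) ≤ η
      - 3 * L / (k + 1) * ((1 / 2) * (A + ‖x' - ws‖ ^ 2 - ‖x - ws‖ ^ 2))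
      + inner ℝ δ (x - ws) + ((k + 1) / (2 * L) * ‖δ‖ ^ 2 + L / (2 * (k + 1)) * A) := by
    rw [e5]; linarith
  have h11 := mul_le_mul_of_nonneg_left h10 hγ0.le
  have h12 : φ y' - φ ws ≤ (1 - γ) * (φ y - φ ws) + γ * (η
      - 3 * L / (k + 1) * ((1 / 2) * (A + ‖x' - ws‖ ^ 2 - ‖x - ws‖ ^ 2))
      + inner ℝ δ (x - ws) + ((k + 1) / (2 * L) * ‖δ‖ ^ 2 + L / (2 * (k + 1)) * A))
      + L / 2 * (γ ^ 2 * A) := by linarith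
  have h13 := mul_le_mul_of_nonneg_left h12 (show (0 : ℝ) ≤ (k + 1) * (k + 2) by positivity)
  -- Origin of the 3 in `β_k = 3L/k`: the proximal term supplies `-3L‖x' - x‖²`, against `L` from
  -- Young and `2L(k+1)/(k+2)` from smoothness, leaving `-2L/(k+2)`.
  have h14 : ((k : ℝ) + 1) * (k + 2) * ((1 - γ) * (φ y - φ ws) + γ * (η
      - 3 * L / (k + 1) * ((1 / 2) * (A + ‖x' - ws‖ ^ 2 - ‖x - ws‖ ^ 2))
      + inner ℝ δ (x - ws) + ((k + 1) / (2 * L) * ‖δ‖ ^ 2 + L / (2 * (k + 1)) * A))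
      + L / 2 * (γ ^ 2 * A))
      = (k : ℝ) * (k + 1) * (φ y - φ ws) + 3 * L * ‖x - ws‖ ^ 2 - 3 * L * ‖x' - ws‖ ^ 2
        + 2 * (k + 1) * η + (k + 1) ^ 2 / L * ‖δ‖ ^ 2
        + 2 * (k + 1) * inner ℝ δ (x - ws) - 2 * L / (k + 2) * A := by
    rw [hγ]
    field_simp
    ring
  have h15 : 0 ≤ 2 * L / (k + 2) * A := by positivity
  linarith

end ConvexAnalysis

/-! ### Convergence of the Frank-Wolfe duality gap -/

section FrankWolfe

variable {d : ℕ} {K : Set (Vec d)} {lmo : Vec d → Vec d}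

theorem fwIter_mem (hK : Convex ℝ K) (hlmo : IsLMO K lmo) (g : Vec d → ℝ) {u₀ : Vec d}
    (hu : u₀ ∈ K) : ∀ j, fwIter lmo g u₀ j ∈ K
  | 0 => hu
  | j + 1 => by
    have h1 : (0 : ℝ) ≤ 2 / (((j + 1 : ℕ) : ℝ) + 1) := by positivity
    have h2 : 2 / (((j + 1 : ℕ) : ℝ) + 1) ≤ 1 := by
      rw [div_le_one (by positivity)]; push_cast; linarith [(j.cast_nonneg : (0 : ℝ) ≤ j)]
    exact hK (fwIter_mem hK hlmo g hu j) (hlmo _).1 (by linarith) h1 (by ring)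

/-- The duality gap as measured by the oracle. -/
noncomputable def fwGap (lmo : Vec d → Vec d) (g : Vec d → ℝ) (u : Vec d) : ℝ :=
  inner ℝ (gradient g u) (u - lmo (gradient g u))

theorem IsLMO.inner_le_fwGap (hlmo : IsLMO K lmo) (g : Vec d → ℝ) (u : Vec d) {x : Vec d}
    (hx : x ∈ K) : inner ℝ (gradient g u) (u - x) ≤ fwGap lmo g u := by
  have := (hlmo (gradient g u)).2 x hx
  rw [fwGap, inner_sub_right, inner_sub_right]
  linarith

variable {β D : ℝ} {xp c : Vec d}

/-- The expansion of the quadratic is exact. With step `2/(j+2)` and weight `(j+1)(j+2)`, the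
curvature term is `2βD²(j+1)/(j+2) ≤ 2βD²`. -/
theorem subObj_fwIter_succ_le (hK : Convex ℝ K) (hlmo : IsLMO K lmo) (hβ : 0 ≤ β)
    (hD : ∀ x ∈ K, ∀ y ∈ K, ‖x - y‖ ≤ D) {u₀ : Vec d} (hu : u₀ ∈ K) (xm : Vec d) (j : ℕ) :
    ((j : ℝ) + 1) * (j + 2)
        * (subObj β xp c (fwIter lmo (subObj β xp c) u₀ (j + 1)) - subObj β xp c xm)
      ≤ (j + 1) * (j + 2)
        * (subObj β xp c (fwIter lmo (subObj β xp c) u₀ j) - subObj β xp c xm)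
        - 2 * (j + 1) * fwGap lmo (subObj β xp c) (fwIter lmo (subObj β xp c) u₀ j)
        + 2 * (β * D ^ 2) := by
  set g := subObj β xp c with hg
  set u := fwIter lmo g u₀ j with hu'
  have humem : u ∈ K := fwIter_mem hK hlmo g hu j
  set v := lmo (gradient g u) with hv
  have hvmem : v ∈ K := (hlmo _).1
  set γ : ℝ := 2 / (((j + 1 : ℕ) : ℝ) + 1) with hγ
  have hγ' : γ = 2 / ((j : ℝ) + 2) := by rw [hγ]; push_cast; ring_nf
  have hsucc : fwIter lmo g u₀ (j + 1) = (1 - γ) • u + γ • v := rfl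
  have e : (1 - γ) • u + γ • v - u = γ • (v - u) := by module
  have h1 := subObj_sub β xp c ((1 - γ) • u + γ • v) u
  rw [e, inner_smul_right, norm_smul, mul_pow, Real.norm_eq_abs, sq_abs, ← hg] at h1
  have hgap : inner ℝ (gradient g u) (v - u) = - fwGap lmo g u := by
    rw [fwGap, ← hv, ← inner_neg_right, neg_sub]
  have hsq : ‖v - u‖ ^ 2 ≤ D ^ 2 := by
    have := hD v hvmem u humem
    gcongr
  rw [hgap] at h1
  have h2 : β / 2 * (γ ^ 2 * ‖v - u‖ ^ 2) ≤ β / 2 * (γ ^ 2 * D ^ 2) := by gcongr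
  have h3 : g ((1 - γ) • u + γ • v) - g xm
      ≤ (g u - g xm) - γ * fwGap lmo g u + β / 2 * (γ ^ 2 * D ^ 2) := by linarith
  rw [hsucc]
  refine (mul_le_mul_of_nonneg_left h3
    (show (0 : ℝ) ≤ ((j : ℝ) + 1) * (j + 2) by positivity)).trans ?_
  have h4 : ((j : ℝ) + 1) * (j + 2)
      * ((g u - g xm) - γ * fwGap lmo g u + β / 2 * (γ ^ 2 * D ^ 2))
      = (j + 1) * (j + 2) * (g u - g xm) - 2 * (j + 1) * fwGap lmo g u
        + 2 * (β * D ^ 2) - 2 * (β * D ^ 2) / (j + 2) := by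
    rw [hγ']
    field_simp
    ring
  rw [h4]
  have : 0 ≤ 2 * (β * D ^ 2) / ((j : ℝ) + 2) := by positivity
  linarith

/-- If every gap before `J` exceeded `η`, the weighted decrease would eventually push the primal
error below zero. -/
theorem exists_gapLE (hKc : IsCompact K) (hK : Convex ℝ K) (hlmo : IsLMO K lmo) (hβ : 0 ≤ β)
    (hD : ∀ x ∈ K, ∀ y ∈ K, ‖x - y‖ ≤ D) {u₀ : Vec d} (hu : u₀ ∈ K) {η : ℝ} {J : ℕ}
    (hη : 0 < η) (hJ2 : 2 ≤ J) (hJ : 6 * (β * D ^ 2) < η * J) :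
    ∃ j < J, GapLE K (subObj β xp c) η (fwIter lmo (subObj β xp c) u₀ j) := by
  set g := subObj β xp c with hg
  have hcont : Continuous g := by
    rw [hg]; unfold subObj; fun_prop
  obtain ⟨xm, hxm, hmin⟩ := hKc.exists_isMinOn ⟨u₀, hu⟩ hcont.continuousOn
  by_contra! hno
  set h : ℕ → ℝ := fun j => g (fwIter lmo g u₀ j) - g xm with hh
  have hmem := fwIter_mem hK hlmo g hu
  have hgap : ∀ j < J, η < fwGap lmo g (fwIter lmo g u₀ j) := fun j hj => by
    have := hno j hj
    unfold GapLE at this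
    push Not at this
    obtain ⟨x, hx, hlt⟩ := this
    exact hlt.trans_le (hlmo.inner_le_fwGap g _ hx)
  have hle : ∀ j, h j ≤ fwGap lmo g (fwIter lmo g u₀ j) := fun j => by
    have h1 := subObj_sub β xp c xm (fwIter lmo g u₀ j)
    have h2 := hlmo.inner_le_fwGap g (fwIter lmo g u₀ j) hxm
    rw [← neg_sub xm, inner_neg_right] at h2
    have h3 : 0 ≤ β / 2 * ‖xm - fwIter lmo g u₀ j‖ ^ 2 := by positivity
    rw [← hg] at h1
    simp only [hh]
    linarith
  have hstep : ∀ j : ℕ, ((j : ℝ) + 1) * (j + 2) * h (j + 1) ≤ (j + 1) * (j + 2) * h j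
      - 2 * (j + 1) * fwGap lmo g (fwIter lmo g u₀ j) + 2 * (β * D ^ 2) := fun j =>
    subObj_fwIter_succ_le hK hlmo hβ hD hu xm j
  set M := β * D ^ 2 with hM
  have hM0 : 0 ≤ M := by positivity
  -- The gap dominates the primal error, so `(j+1)(j+2)h_j - 2(j+1)h_j = j(j+1)h_j` telescopes to
  -- the rate `h_j ≤ 2M/(j+1)`.
  have hprimal : ∀ j : ℕ, (j : ℝ) * (j + 1) * h j ≤ 2 * M * j := fun j => by
    induction j with
    | zero => simp
    | succ j ih =>
      have h1 := hstep j
      have h2 := mul_le_mul_of_nonneg_left (hle j) (show (0 : ℝ) ≤ 2 * (j + 1) by positivity)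
      push_cast
      nlinarith
  -- From index 1 on, the gap is bounded below by `η` instead. The surplus `2(j+2)h_{j+1}` is at
  -- most `4M` by the primal rate, so a step adds `4M + 2M` and removes `2(j+2)η`. Index 0
  -- contributes no `η`, hence the `- 2`.
  have hdual : ∀ j : ℕ, j + 1 ≤ J → ((j : ℝ) + 1) * (j + 2) * h (j + 1)
      ≤ 6 * M * (j + 1) - η * ((j + 1) * (j + 2) - 2) := fun j => by
    induction j with
    | zero =>
      intro _
      have := hprimal 1
      norm_num at this ⊢
      linarith
    | succ j ih =>
      intro hj
      have h1 := hstep (j + 1)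
      have h2 := hgap (j + 1) (by lia)
      have h3 := ih (by lia)
      have h4 := hprimal (j + 1)
      have h5 : ((j : ℝ) + 2) * h (j + 1) ≤ 2 * M := by
        have hj1 : (0 : ℝ) < j + 1 := by positivity
        push_cast at h4
        refine le_of_mul_le_mul_left ?_ hj1
        linarith
      have h6 := mul_le_mul_of_nonneg_left h2.le (show (0 : ℝ) ≤ 2 * (j + 2) by positivity)
      push_cast at h1 ⊢
      nlinarith
  obtain ⟨j, rfl⟩ : ∃ j, J = j + 1 := ⟨J - 1, by lia⟩
  have h1 := hdual j le_rfl
  have h2 : 0 ≤ h (j + 1) := sub_nonneg.2 (hmin (hmem (j + 1)))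
  have hj1 : (1 : ℝ) ≤ j := by exact_mod_cast (by lia : 1 ≤ j)
  have h3 : 0 ≤ ((j : ℝ) + 1) * (j + 2) * h (j + 1) := by positivity
  have h4 : η * (((j : ℝ) + 1) * (j + 1)) ≤ η * ((j + 1) * (j + 2) - 2) := by
    gcongr; linarith
  push_cast at hJ
  have h5 := mul_lt_mul_of_pos_right hJ (show (0 : ℝ) < j + 1 by positivity)
  linarith

theorem fwStop_le_and_gapLE (hKc : IsCompact K) (hK : Convex ℝ K) (hlmo : IsLMO K lmo)
    (hβ : 0 ≤ β) (hD : ∀ x ∈ K, ∀ y ∈ K, ‖x - y‖ ≤ D) {u₀ : Vec d} (hu : u₀ ∈ K) {η : ℝ} {J : ℕ}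
    (hη : 0 < η) (hJ2 : 2 ≤ J) (hJ : 6 * (β * D ^ 2) < η * J) :
    fwStop K lmo (subObj β xp c) η u₀ ≤ (J : ℕ∞) ∧
      GapLE K (subObj β xp c) η (fwOut K lmo (subObj β xp c) η u₀) := by
  obtain ⟨j, hj, hgap⟩ := exists_gapLE (xp := xp) (c := c) hKc hK hlmo hβ hD hu hη hJ2 hJ
  set A := {N : ℕ∞ | ∃ j : ℕ, GapLE K (subObj β xp c) η
    (fwIter lmo (subObj β xp c) u₀ j) ∧ N = (j : ℕ∞)} with hA
  have hjA : (j : ℕ∞) ∈ A := ⟨j, hgap, rfl⟩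
  refine ⟨(sInf_le hjA).trans (by exact_mod_cast hj.le), ?_⟩
  obtain ⟨i, hi, he⟩ := csInf_mem (⟨_, hjA⟩ : A.Nonempty)
  have : fwStop K lmo (subObj β xp c) η u₀ = (i : ℕ∞) := he
  rw [fwOut, this]
  exact hi

end FrankWolfe

/-! ### Expectations of functions of finitely many samples -/

section Sampling

/-- A function of a family of samples that depends on finitely many of them only. -/
def FinDep {ι A B : Type*} (H : (ι → A) → B) : Prop := ∃ I : Finset ι, DependsOn H (I : Set ι)

section Closure

variable {ι A B B' C : Type*}

theorem finDep_const (b : B) : FinDep (fun _ : ι → A => b) := ⟨∅, fun _ _ _ => rfl⟩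

theorem finDep_apply (a : ι) : FinDep (fun ω : ι → A => ω a) := ⟨{a}, fun _ _ h => h a (by simp)⟩

theorem FinDep.comp {H : (ι → A) → B} (h : FinDep H) (φ : B → C) : FinDep (fun ω => φ (H ω)) := by
  obtain ⟨I, hI⟩ := h
  exact ⟨I, fun x y hxy => congrArg φ (hI hxy)⟩

theorem FinDep.comp₂ {H : (ι → A) → B} {H' : (ι → A) → B'} (h : FinDep H) (h' : FinDep H')
    (φ : B → B' → C) : FinDep (fun ω => φ (H ω) (H' ω)) := by
  classical
  obtain ⟨I, hI⟩ := h
  obtain ⟨I', hI'⟩ := h'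
  refine ⟨I ∪ I', fun x y hxy => ?_⟩
  simp only
  rw [hI fun i hi => hxy i (by simp_all), hI' fun i hi => hxy i (by simp_all)]

theorem FinDep.sum {κ : Type*} [AddCommMonoid B] (s : Finset κ) {H : κ → (ι → A) → B}
    (h : ∀ j ∈ s, FinDep (H j)) : FinDep (fun ω => ∑ j ∈ s, H j ω) := by
  classical
  induction s using Finset.induction_on with
  | empty => simpa using finDep_const (0 : B)
  | insert a s ha ih =>
    simp only [Finset.sum_insert ha]
    exact (h a (by simp)).comp₂ (ih fun j hj => h j (by simp [hj])) (· + ·)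

end Closure

variable {S : Type*} [MeasurableSpace S] {P : Measure S} {n : ℕ}
  {ξ : ℕ × ℕ × ℕ → S → Fin n}

/-- Expectation of a function of the samples. -/
noncomputable def mean (P : Measure S) (ξ : ℕ × ℕ × ℕ → S → Fin n)
    (H : (ℕ × ℕ × ℕ → Fin n) → ℝ) : ℝ :=
  ∫ s, H (fun a => ξ a s) ∂P

theorem mean_const_mul (c : ℝ) (H : (ℕ × ℕ × ℕ → Fin n) → ℝ) :
    mean P ξ (fun ω => c * H ω) = c * mean P ξ H :=
  integral_const_mul c _

theorem nonempty_of_samples (P : Measure S) [IsProbabilityMeasure P]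
    (ξ : ℕ × ℕ × ℕ → S → Fin n) : Nonempty (Fin n) := by
  obtain ⟨s⟩ := nonempty_of_isProbabilityMeasure P
  exact ⟨ξ (0, 0, 0) s⟩

theorem exists_eq_restrict_of_dependsOn [Nonempty (Fin n)] {H : (ℕ × ℕ × ℕ → Fin n) → ℝ}
    {I : Finset (ℕ × ℕ × ℕ)} (hH : DependsOn H (I : Set (ℕ × ℕ × ℕ))) :
    ∃ h : (I → Fin n) → ℝ, ∀ ω, H ω = h (fun a => ω a) := by
  classical
  obtain ⟨i₀⟩ := ‹Nonempty (Fin n)›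
  -- Coordinates outside `I` receive the arbitrary value `i₀`, to which `H` is blind.
  refine ⟨fun v => H fun a => if ha : a ∈ I then v ⟨a, ha⟩ else i₀, fun ω => hH fun a ha => ?_⟩
  have : a ∈ I := ha
  simp [this]

variable [IsProbabilityMeasure P]

theorem FinDep.integrable (hξ : UniformSamples P ξ) {H : (ℕ × ℕ × ℕ → Fin n) → ℝ}
    (hH : FinDep H) : Integrable (fun s => H fun a => ξ a s) P := by
  obtain ⟨I, hI⟩ := hH
  have := nonempty_of_samples P ξ
  obtain ⟨h, hh⟩ := exists_eq_restrict_of_dependsOn hI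
  simp only [hh]
  have hm : Measurable (fun s => fun a : I => ξ a s) := measurable_pi_lambda _ fun a =>
    hξ.measurable a
  have : Integrable h (P.map fun s => fun a : I => ξ a s) := by
    have := Measure.isProbabilityMeasure_map (μ := P) hm.aemeasurable
    exact Integrable.of_finite
  exact this.comp_measurable hm

theorem mean_add (hξ : UniformSamples P ξ) {H H' : (ℕ × ℕ × ℕ → Fin n) → ℝ} (h : FinDep H)
    (h' : FinDep H') : mean P ξ (fun ω => H ω + H' ω) = mean P ξ H + mean P ξ H' :=
  integral_add (h.integrable hξ) (h'.integrable hξ)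

theorem mean_const (c : ℝ) : mean P ξ (fun _ => c) = c := by simp [mean]

theorem mean_mono (hξ : UniformSamples P ξ) {H H' : (ℕ × ℕ × ℕ → Fin n) → ℝ} (h : FinDep H)
    (h' : FinDep H') (hle : ∀ ω, H ω ≤ H' ω) : mean P ξ H ≤ mean P ξ H' :=
  integral_mono (h.integrable hξ) (h'.integrable hξ) fun _ => hle _

theorem mean_sum (hξ : UniformSamples P ξ) {κ : Type*} (s : Finset κ)
    {H : κ → (ℕ × ℕ × ℕ → Fin n) → ℝ} (h : ∀ j ∈ s, FinDep (H j)) :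
    mean P ξ (fun ω => ∑ j ∈ s, H j ω) = ∑ j ∈ s, mean P ξ (H j) :=
  integral_finsetSum s fun j hj => (h j hj).integrable hξ

theorem UniformSamples.integral_map (hξ : UniformSamples P ξ) (a : ℕ × ℕ × ℕ) (h : Fin n → ℝ) :
    ∫ i, h i ∂(P.map (ξ a)) = (1 / (n : ℝ)) * ∑ i, h i := by
  have := Measure.isProbabilityMeasure_map (μ := P) (hξ.measurable a).aemeasurable
  rw [integral_fintype Integrable.of_finite, Finset.mul_sum]
  refine Finset.sum_congr rfl fun i _ => ?_
  have : (P.map (ξ a)) {i} = (n : ℝ≥0∞)⁻¹ := by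
    rw [Measure.map_apply (hξ.measurable a) (measurableSet_singleton i), ← hξ.uniform a i]
    rfl
  rw [Measure.real, this]
  simp

/-- A sample may be replaced by a fresh uniform one without changing the expectation. -/
theorem mean_resample (hξ : UniformSamples P ξ) {H : (ℕ × ℕ × ℕ → Fin n) → ℝ} (hH : FinDep H)
    (a : ℕ × ℕ × ℕ) :
    mean P ξ H = mean P ξ (fun ω => (1 / (n : ℝ)) * ∑ i, H (Function.update ω a i)) := by
  classical
  obtain ⟨I, hI⟩ := hH
  set J := I.erase a with hJ
  obtain ⟨i₀⟩ := nonempty_of_samples P ξ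
  set X : S → (J → Fin n) := fun s b => ξ b s with hX
  have hXm : Measurable X := measurable_pi_lambda _ fun b => hξ.measurable b
  -- The other relevant samples are jointly independent of sample `a`, so their law is a product and
  -- Fubini applies.
  have hind : IndepFun X (ξ a) P := by
    have := hξ.indep.indepFun_finset J {a} (by simp [hJ]) hξ.measurable
    exact this.comp (φ := id) (ψ := fun v : (({a} : Finset (ℕ × ℕ × ℕ)) → Fin n) =>
      v ⟨a, by simp⟩) measurable_id (measurable_pi_apply _)
  set h : (J → Fin n) → Fin n → ℝ := fun v i =>
    H (Function.update (fun b => if hb : b ∈ J then v ⟨b, hb⟩ else i₀) a i) with hh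
  have hup : ∀ s i, H (Function.update (fun b => ξ b s) a i) = h (X s) i := fun s i => by
    refine hI fun b hb => ?_
    by_cases hba : b = a
    · subst hba; simp
    · have : b ∈ J := by simp only [hJ, Finset.mem_erase]; exact ⟨hba, hb⟩
      simp [hba, this, hX]
  have hself : ∀ s, H (fun b => ξ b s) = h (X s) (ξ a s) := fun s => by
    rw [← hup, Function.update_eq_self_iff.2 rfl]
  simp only [mean, hup, hself]
  have := Measure.isProbabilityMeasure_map (μ := P) hXm.aemeasurable
  have := Measure.isProbabilityMeasure_map (μ := P) (hξ.measurable a).aemeasurable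
  have hmap := hind.map_prod_eq_prod_map_map hXm.aemeasurable (hξ.measurable a).aemeasurable
  calc ∫ s, h (X s) (ξ a s) ∂P
      = ∫ p, h p.1 p.2 ∂(P.map fun s => (X s, ξ a s)) := by
        rw [integral_map (hXm.prodMk (hξ.measurable a)).aemeasurable]
        exact (Measurable.of_discrete).aestronglyMeasurable
    _ = ∫ v, ∫ i, h v i ∂(P.map (ξ a)) ∂(P.map X) := by
        rw [hmap, integral_prod]
        exact Integrable.of_finite
    _ = ∫ v, (1 / (n : ℝ)) * ∑ i, h v i ∂(P.map X) := by simp_rw [hξ.integral_map]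
    _ = _ := by
        rw [integral_map hXm.aemeasurable]
        exact (Measurable.of_discrete).aestronglyMeasurable

/-- `H` does not depend on the sample `a`. -/
def Free {n : ℕ} {B : Type*} (a : ℕ × ℕ × ℕ) (H : (ℕ × ℕ × ℕ → Fin n) → B) : Prop :=
  ∀ ω i, H (Function.update ω a i) = H ω

variable {d : ℕ}

/-- Resampling `a` fixes `q` and `u`, and averaging over the fresh index produces `⟨∑ i, q i, u⟩ =
0`. -/
theorem mean_inner_eq_zero (hξ : UniformSamples P ξ) {q : (ℕ × ℕ × ℕ → Fin n) → Fin n → Vec d}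
    {u : (ℕ × ℕ × ℕ → Fin n) → Vec d} {a : ℕ × ℕ × ℕ} (hq : FinDep q) (hu : FinDep u)
    (hqa : Free a q) (hua : Free a u) (h0 : ∀ ω, ∑ i, q ω i = 0) :
    mean P ξ (fun ω => inner ℝ (q ω (ω a)) (u ω)) = 0 := by
  have hdep : FinDep fun ω : ℕ × ℕ × ℕ → Fin n => (inner ℝ (q ω (ω a)) (u ω) : ℝ) :=
    (hq.comp₂ (finDep_apply a) fun f i => f i).comp₂ hu fun x y => (inner ℝ x y : ℝ)
  rw [mean_resample hξ hdep a]
  have : ∀ ω : ℕ × ℕ × ℕ → Fin n, (1 / (n : ℝ)) * ∑ i, (inner ℝ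
      (q (Function.update ω a i) (Function.update ω a i a)) (u (Function.update ω a i)) : ℝ)
      = 0 := fun ω => by
    simp only [hqa ω, hua ω, Function.update_self, ← sum_inner, h0, inner_zero_left, mul_zero]
  simp only [this, mean_const]

theorem mean_norm_sq_eq (hξ : UniformSamples P ξ) {q : (ℕ × ℕ × ℕ → Fin n) → Fin n → Vec d}
    {a : ℕ × ℕ × ℕ} (hq : FinDep q) (hqa : Free a q) :
    mean P ξ (fun ω => ‖q ω (ω a)‖ ^ 2)
      = mean P ξ (fun ω => (1 / (n : ℝ)) * ∑ i, ‖q ω i‖ ^ 2) := by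
  have hdep : FinDep fun ω : ℕ × ℕ × ℕ → Fin n => ‖q ω (ω a)‖ ^ 2 :=
    hq.comp₂ (finDep_apply a) fun f i => ‖f i‖ ^ 2
  rw [mean_resample hξ hdep a]
  simp only [hqa _, Function.update_self]

/-- The average of `m` conditionally independent centered vectors has its variance divided
by `m`. -/
theorem mean_norm_batch_sq (hξ : UniformSamples P ξ) {q : (ℕ × ℕ × ℕ → Fin n) → Fin n → Vec d}
    {m : ℕ} (hm : 0 < m) {a : ℕ → ℕ × ℕ × ℕ} (ha : Function.Injective a) (hq : FinDep q)
    (hqa : ∀ j, Free (a j) q) (h0 : ∀ ω, ∑ i, q ω i = 0) :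
    mean P ξ (fun ω => ‖(1 / (m : ℝ)) • ∑ j ∈ Finset.range m, q ω (ω (a j))‖ ^ 2)
      = (1 / (m : ℝ)) * mean P ξ (fun ω => (1 / (n : ℝ)) * ∑ i, ‖q ω i‖ ^ 2) := by
  have hdep : ∀ j, FinDep fun ω : ℕ × ℕ × ℕ → Fin n => q ω (ω (a j)) := fun j =>
    hq.comp₂ (finDep_apply (a j)) fun f i => f i
  have hin : ∀ j l, FinDep fun ω : ℕ × ℕ × ℕ → Fin n =>
      (inner ℝ (q ω (ω (a j))) (q ω (ω (a l))) : ℝ) := fun j l =>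
    (hdep j).comp₂ (hdep l) fun x y => (inner ℝ x y : ℝ)
  have hexp : ∀ ω : ℕ × ℕ × ℕ → Fin n,
      ‖(1 / (m : ℝ)) • ∑ j ∈ Finset.range m, q ω (ω (a j))‖ ^ 2 = (1 / (m : ℝ)) ^ 2 *
        ∑ j ∈ Finset.range m, ∑ l ∈ Finset.range m,
          (inner ℝ (q ω (ω (a j))) (q ω (ω (a l))) : ℝ) := fun ω => by
    rw [norm_smul, mul_pow, Real.norm_eq_abs, sq_abs, ← real_inner_self_eq_norm_sq, sum_inner]
    simp_rw [inner_sum]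
  simp only [hexp]
  rw [mean_const_mul, mean_sum hξ _ fun j _ => FinDep.sum _ fun l _ => hin j l]
  have hrow : ∀ j ∈ Finset.range m, mean P ξ (fun ω => ∑ l ∈ Finset.range m,
      (inner ℝ (q ω (ω (a j))) (q ω (ω (a l))) : ℝ))
      = mean P ξ (fun ω => (1 / (n : ℝ)) * ∑ i, ‖q ω i‖ ^ 2) := fun j hj => by
    -- Cross terms vanish: for `l ≠ j`, resampling `a j` changes neither `q` nor the sample at `a
    -- l`.
    rw [mean_sum hξ _ fun l _ => hin j l, Finset.sum_eq_single_of_mem j hj]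
    · simp_rw [real_inner_self_eq_norm_sq]
      exact mean_norm_sq_eq hξ hq (hqa j)
    · intro l _ hlj
      refine mean_inner_eq_zero hξ hq (hdep l) (hqa j) (fun ω i => ?_) h0
      simp only [hqa j ω]
      rw [Function.update_of_ne (ha.ne hlj)]
  rw [Finset.sum_congr rfl hrow, Finset.sum_const, Finset.card_range, nsmul_eq_mul]
  field_simp

end Sampling

/-! ### Which samples each iterate depends on -/

section Dependence

variable {d n : ℕ} (p : Params) (K : Set (Vec d)) (F : Fin n → Vec d → ℝ) (lmo : Vec d → Vec d)
  (x₀ : Vec d)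

theorem innerLoop_congr (t : ℕ) (y₀ g₀ : Vec d) {ζ ζ' : ℕ → ℕ → Fin n} (k : ℕ)
    (h : ∀ k' ≤ k, ∀ j < p.m t k', ζ k' j = ζ' k' j) :
    innerLoop p K F lmo t y₀ g₀ ζ k = innerLoop p K F lmo t y₀ g₀ ζ' k := by
  induction k with
  | zero => rfl
  | succ k ih =>
    have hb : ∀ z, batch F y₀ g₀ z (p.m t (k + 1)) (ζ (k + 1))
        = batch F y₀ g₀ z (p.m t (k + 1)) (ζ' (k + 1)) := fun z => by
      unfold batch
      congr 1
      exact Finset.sum_congr rfl fun j hj => by rw [h _ le_rfl j (Finset.mem_range.1 hj)]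
    simp only [innerLoop, innerStep, ih fun k' hk' => h k' (by lia), hb]

theorem run_congr {ζ ζ' : ℕ → ℕ → ℕ → Fin n} (t : ℕ)
    (h : ∀ t' ≤ t, ∀ k' ≤ p.N t', ∀ j < p.m t' k', ζ t' k' j = ζ' t' k' j) :
    run p K F lmo x₀ ζ t = run p K F lmo x₀ ζ' t := by
  induction t with
  | zero => rfl
  | succ t ih =>
    simp only [run, ih fun t' ht' => h t' (by lia)]
    rw [innerLoop_congr p K F lmo _ _ _ _ (h (t + 1) le_rfl)]

/-- The run as a function of the family of samples. -/
noncomputable def runAt (t : ℕ) (ω : ℕ × ℕ × ℕ → Fin n) : Outer d :=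
  run p K F lmo x₀ (fun t k j => ω (t, k, j)) t

/-- The inner state after `k` iterations of round `t + 1`, as a function of the samples. -/
noncomputable def innerAt (t k : ℕ) (ω : ℕ × ℕ × ℕ → Fin n) : Inner d :=
  innerLoop p K F lmo (t + 1) (runAt p K F lmo x₀ t ω).w
    (gradient (avg F) (runAt p K F lmo x₀ t ω).w) (fun k j => ω (t + 1, k, j)) k

theorem runAt_succ_w (t : ℕ) (ω : ℕ × ℕ × ℕ → Fin n) :
    (runAt p K F lmo x₀ (t + 1) ω).w = (innerAt p K F lmo x₀ t (p.N (t + 1)) ω).y := rfl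

/-- The samples drawn in iterations up to `k t'` of the rounds `t' ≤ t`. -/
def usedSamples (p : Params) (t : ℕ) (k : ℕ → ℕ) : Finset (ℕ × ℕ × ℕ) :=
  (Finset.range (t + 1)).biUnion fun t' => (Finset.range (k t' + 1)).biUnion fun k' =>
    (Finset.range (p.m t' k')).image fun j => (t', k', j)

theorem mem_usedSamples {t : ℕ} {k : ℕ → ℕ} {t' k' j : ℕ} (ht : t' ≤ t) (hk : k' ≤ k t')
    (hj : j < p.m t' k') : (t', k', j) ∈ usedSamples p t k := by
  simp only [usedSamples, Finset.mem_biUnion, Finset.mem_range, Finset.mem_image]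
  exact ⟨t', by lia, k', by lia, j, hj, rfl⟩

theorem finDep_runAt (t : ℕ) : FinDep (runAt p K F lmo x₀ t) :=
  ⟨usedSamples p t p.N, fun _ _ h => run_congr p K F lmo x₀ t fun _ ht _ hk _ hj =>
    h _ (mem_usedSamples p ht hk hj)⟩

theorem finDep_innerAt (t k : ℕ) : FinDep (innerAt p K F lmo x₀ t k) := by
  have h2 : FinDep (fun ω : ℕ × ℕ × ℕ → Fin n => fun y₀ g₀ =>
      innerLoop p K F lmo (t + 1) y₀ g₀ (fun k j => ω (t + 1, k, j)) k) :=
    ⟨usedSamples p (t + 1) fun _ => k, fun _ _ h => funext fun _ => funext fun _ =>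
      innerLoop_congr p K F lmo _ _ _ _ fun _ hk _ hj => h _ (mem_usedSamples p le_rfl hk hj)⟩
  exact (finDep_runAt p K F lmo x₀ t).comp₂ h2 fun s f => f s.w (gradient (avg F) s.w)

theorem free_runAt (t k j : ℕ) : Free (t + 1, k, j) (runAt p K F lmo x₀ t) := fun ω i => by
  refine run_congr p K F lmo x₀ t fun t' ht' k' _ j' _ => ?_
  rw [Function.update_of_ne]
  simp only [ne_eq, Prod.mk.injEq, not_and]
  lia

/-- Up to iteration `k` of round `t + 1` only earlier samples are read, so the batch of iteration `k
+ 1` is fresh given the current state. -/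
theorem free_innerAt (t k j : ℕ) : Free (t + 1, k + 1, j) (innerAt p K F lmo x₀ t k) :=
  fun ω i => by
  unfold innerAt
  rw [free_runAt p K F lmo x₀ t (k + 1) j ω i]
  refine innerLoop_congr p K F lmo _ _ _ _ fun k' hk' j' _ => ?_
  rw [Function.update_of_ne]
  simp only [ne_eq, Prod.mk.injEq, not_and]
  lia

end Dependence

/-- The standing assumptions on the optimization problem. -/
structure Problem {d n : ℕ} (L D : ℝ) (K : Set (Vec d)) (F : Fin n → Vec d → ℝ)
    (lmo : Vec d → Vec d) (ws : Vec d) : Prop where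
  L_pos : 0 < L
  n_pos : 0 < n
  compact : IsCompact K
  convex : Convex ℝ K
  norm_sub_le : ∀ x ∈ K, ∀ y ∈ K, ‖x - y‖ ≤ D
  smooth : ∀ i, ConvexSmooth L (F i)
  isLMO : IsLMO K lmo
  mem : ws ∈ K
  isMin : IsMinOn (avg F) K ws

/-- Bound on the number of linear optimizations in one inner iteration. -/
noncomputable def linBound (D Q : ℝ) (N : ℕ) : ℕ := ⌊9 * (N : ℝ) * D ^ 2 / Q⌋₊ + 3

/-! ### One inner iteration: feasibility, oracle counts and growth of the potential -/

section Step

variable {d n : ℕ} {L D : ℝ} {K : Set (Vec d)} {F : Fin n → Vec d → ℝ} {lmo : Vec d → Vec d}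
  {ws : Vec d} {Dsq : ℕ → ℝ} {N : ℕ → ℕ} {m : ℕ → ℕ → ℕ}

theorem Problem.gap_nonneg (h : Problem L D K F lmo ws) {w : Vec d} (hw : w ∈ K) :
    0 ≤ avg F w - avg F ws := sub_nonneg.2 (h.isMin hw)

theorem Problem.fwStop_le_and_gapLE (h : Problem L D K F lmo ws) {t : ℕ} (hQ : 0 < Dsq t)
    (hN : 0 < N t) {x : Vec d} (hx : x ∈ K) (g : Vec d) (k : ℕ) :
    fwStop K lmo (subObj ((mkParams L Dsq N m).β (k + 1)) x g) ((mkParams L Dsq N m).η t (k + 1)) x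
        + 1 ≤ (linBound D (Dsq t) (N t) : ℕ∞) ∧
      GapLE K (subObj ((mkParams L Dsq N m).β (k + 1)) x g) ((mkParams L Dsq N m).η t (k + 1))
        (fwOut K lmo (subObj ((mkParams L Dsq N m).β (k + 1)) x g)
          ((mkParams L Dsq N m).η t (k + 1)) x) := by
  have hL := h.L_pos
  have hN' : (0 : ℝ) < N t := by exact_mod_cast hN
  -- In `6βD² < ηJ` the factor `k` cancels, leaving `9 N D² < J D_t²`. The `+ 2` makes the
  -- inequality strict and secures `2 ≤ J`; one more unit in `linBound` counts the optimization at
  -- the stopping point.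
  set J := ⌊9 * (N t : ℝ) * D ^ 2 / Dsq t⌋₊ + 2 with hJ
  have hJlt : 9 * (N t : ℝ) * D ^ 2 / Dsq t < J := by
    have := Nat.lt_floor_add_one (9 * (N t : ℝ) * D ^ 2 / Dsq t)
    rw [hJ]; push_cast; linarith
  rw [div_lt_iff₀ hQ] at hJlt
  have key := STORC.fwStop_le_and_gapLE (β := (mkParams L Dsq N m).β (k + 1))
    (η := (mkParams L Dsq N m).η t (k + 1)) (xp := x) (c := g) (J := J) h.compact h.convex h.isLMO
    (by simp only [mkParams]; positivity) h.norm_sub_le hx (by simp only [mkParams]; positivity)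
    (by lia) (by
      simp only [mkParams]
      have e1 : 6 * (3 * L / ((k + 1 : ℕ) : ℝ) * D ^ 2)
          = 2 * L / ((N t : ℝ) * ((k + 1 : ℕ) : ℝ)) * (9 * (N t : ℝ) * D ^ 2) := by
        field_simp; ring
      have e2 : 2 * L * Dsq t / ((N t : ℝ) * ((k + 1 : ℕ) : ℝ)) * (J : ℝ)
          = 2 * L / ((N t : ℝ) * ((k + 1 : ℕ) : ℝ)) * (J * Dsq t) := by
        field_simp
      rw [e1, e2]
      gcongr)
  refine ⟨?_, key.2⟩
  have : (linBound D (Dsq t) (N t) : ℕ∞) = (J : ℕ∞) + 1 := by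
    rw [linBound, hJ]; push_cast; ring
  rw [this]
  gcongr
  exact key.1

theorem Problem.innerStep_mem (h : Problem L D K F lmo ws) {t : ℕ} {y₀ g₀ : Vec d} (k : ℕ)
    (ζ : ℕ → Fin n) {s : Inner d} (hx : s.x ∈ K) (hy : s.y ∈ K) :
    (innerStep (mkParams L Dsq N m) K F lmo t y₀ g₀ (k + 1) ζ s).x ∈ K ∧
      (innerStep (mkParams L Dsq N m) K F lmo t y₀ g₀ (k + 1) ζ s).y ∈ K := by
  have h1 : (innerStep (mkParams L Dsq N m) K F lmo t y₀ g₀ (k + 1) ζ s).x ∈ K :=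
    fwIter_mem h.convex h.isLMO _ hx _
  have h2 : (0 : ℝ) ≤ 2 / (((k + 1 : ℕ) : ℝ) + 1) := by positivity
  have h3 : 2 / (((k + 1 : ℕ) : ℝ) + 1) ≤ 1 := by
    rw [div_le_one (by positivity)]; push_cast; linarith [(k.cast_nonneg : (0 : ℝ) ≤ k)]
  exact ⟨h1, h.convex hy h1 (sub_nonneg.2 h3) h2 (sub_add_cancel _ _)⟩

theorem Problem.innerLoop_mem (h : Problem L D K F lmo ws) {t : ℕ} {y₀ g₀ : Vec d}
    (hy₀ : y₀ ∈ K) (ζ : ℕ → ℕ → Fin n) (k : ℕ) :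
    (innerLoop (mkParams L Dsq N m) K F lmo t y₀ g₀ ζ k).x ∈ K ∧
      (innerLoop (mkParams L Dsq N m) K F lmo t y₀ g₀ ζ k).y ∈ K := by
  induction k with
  | zero => exact ⟨hy₀, hy₀⟩
  | succ k ih => exact h.innerStep_mem k _ ih.1 ih.2

theorem Problem.run_mem (h : Problem L D K F lmo ws) (x₀ : Vec d) (ζ : ℕ → ℕ → ℕ → Fin n) (t : ℕ) :
    (run (mkParams L Dsq N m) K F lmo x₀ ζ t).w ∈ K := by
  induction t with
  | zero => exact (h.isLMO _).1
  | succ t ih => exact (h.innerLoop_mem ih _ _).2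

theorem Problem.innerLoop_lin_le (h : Problem L D K F lmo ws) {t : ℕ} (hQ : 0 < Dsq t)
    (hN : 0 < N t) {y₀ g₀ : Vec d} (hy₀ : y₀ ∈ K) (ζ : ℕ → ℕ → Fin n) (k : ℕ) :
    (innerLoop (mkParams L Dsq N m) K F lmo t y₀ g₀ ζ k).lin
      ≤ ((k * linBound D (Dsq t) (N t) : ℕ) : ℕ∞) := by
  induction k with
  | zero => simp [innerLoop]
  | succ k ih =>
    have hx := (h.innerLoop_mem (Dsq := Dsq) (N := N) (m := m) (t := t) (g₀ := g₀) hy₀ ζ k).1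
    rw [add_mul, one_mul, Nat.cast_add]
    exact add_le_add ih (h.fwStop_le_and_gapLE hQ hN hx _ k).1

theorem Problem.run_lin_le (h : Problem L D K F lmo ws) (hQ : ∀ t, 0 < Dsq t) (hN : ∀ t, 0 < N t)
    (x₀ : Vec d) (ζ : ℕ → ℕ → ℕ → Fin n) (T : ℕ) :
    (run (mkParams L Dsq N m) K F lmo x₀ ζ T).lin ≤ ((1 + ∑ t ∈ Finset.range T,
      N (t + 1) * linBound D (Dsq (t + 1)) (N (t + 1)) : ℕ) : ℕ∞) := by
  induction T with
  | zero => simp [run]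
  | succ T ih =>
    rw [Finset.sum_range_succ, ← add_assoc, Nat.cast_add]
    exact add_le_add ih (h.innerLoop_lin_le (hQ _) (hN _) (h.run_mem x₀ ζ T) _ _)

theorem innerLoop_stoch (p : Params) (t : ℕ) (y₀ g₀ : Vec d) (ζ : ℕ → ℕ → Fin n) (k : ℕ) :
    (innerLoop p K F lmo t y₀ g₀ ζ k).stoch = ∑ j ∈ Finset.range k, 2 * p.m t (j + 1) := by
  induction k with
  | zero => rfl
  | succ k ih => rw [Finset.sum_range_succ, ← ih]; rfl

theorem run_stoch (p : Params) (x₀ : Vec d) (ζ : ℕ → ℕ → ℕ → Fin n) (T : ℕ) :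
    (run p K F lmo x₀ ζ T).stoch
      = ∑ t ∈ Finset.range T, ∑ j ∈ Finset.range (p.N (t + 1)), 2 * p.m (t + 1) (j + 1) := by
  induction T with
  | zero => rfl
  | succ T ih => rw [Finset.sum_range_succ, ← ih, ← innerLoop_stoch (K := K)]; rfl

theorem run_exact (p : Params) (x₀ : Vec d) (ζ : ℕ → ℕ → ℕ → Fin n) (T : ℕ) :
    (run p K F lmo x₀ ζ T).exact = T + 1 := by
  induction T with
  | zero => rfl
  | succ T ih => exact congrArg (· + 1) ih

/-- The potential of the accelerated scheme. -/
noncomputable def potential (L : ℝ) (F : Fin n → Vec d → ℝ) (ws : Vec d) (k : ℕ) (s : Inner d) :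
    ℝ :=
  (k : ℝ) * (k + 1) * (avg F s.y - avg F ws) + 3 * L * ‖s.x - ws‖ ^ 2

/-- The extrapolated point of iteration `k + 1`. -/
noncomputable def extrapolate (k : ℕ) (s : Inner d) : Vec d :=
  (1 - 2 / ((k + 1 : ℕ) + 1 : ℝ)) • s.y + (2 / ((k + 1 : ℕ) + 1 : ℝ)) • s.x

/-- The error of the averaged stochastic gradient of iteration `k + 1`. -/
noncomputable def batchErr (F : Fin n → Vec d → ℝ) (y₀ z : Vec d) (m : ℕ) (ζ : ℕ → Fin n) :
    Vec d :=
  (1 / (m : ℝ)) • ∑ j ∈ Finset.range m, vrErr F y₀ z (ζ j)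

theorem gradient_sub_batch (y₀ z : Vec d) {m : ℕ} (hm : 0 < m) (ζ : ℕ → Fin n) :
    gradient (avg F) z - batch F y₀ (gradient (avg F) y₀) z m ζ = batchErr F y₀ z m ζ := by
  have hm' : (m : ℝ) ≠ 0 := by exact_mod_cast hm.ne'
  simp only [batchErr, batch, vrErr, Finset.sum_sub_distrib, Finset.sum_const, Finset.card_range,
    ← Nat.cast_smul_eq_nsmul ℝ, smul_sub, smul_smul, one_div, inv_mul_cancel₀ hm', one_smul]

theorem Problem.potential_innerStep_le (h : Problem L D K F lmo ws) {t : ℕ} (hQ : 0 < Dsq t)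
    (hN : 0 < N t) (y₀ : Vec d) (k : ℕ) (hm : 0 < m t (k + 1)) (ζ : ℕ → Fin n) {s : Inner d}
    (hx : s.x ∈ K) :
    potential L F ws (k + 1)
        (innerStep (mkParams L Dsq N m) K F lmo t y₀ (gradient (avg F) y₀) (k + 1) ζ s)
      ≤ potential L F ws k s + 4 * L * Dsq t / N t
        + (k + 1) ^ 2 / L * ‖batchErr F y₀ (extrapolate k s) (m t (k + 1)) ζ‖ ^ 2
        + 2 * (k + 1) * inner ℝ (batchErr F y₀ (extrapolate k s) (m t (k + 1)) ζ) (s.x - ws) := by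
  have hN' : (N t : ℝ) ≠ 0 := by exact_mod_cast hN.ne'
  rw [← gradient_sub_batch y₀ _ hm]
  have hgap := (h.fwStop_le_and_gapLE (m := m) hQ hN hx
    (batch F y₀ (gradient (avg F) y₀) (extrapolate k s) (m t (k + 1)) ζ) k).2 ws h.mem
  have key := (avg_convexSmooth h.n_pos h.smooth).step_le h.L_pos (y := s.y)
    (z := extrapolate k s) rfl hgap
  have e : 2 * ((k : ℝ) + 1) * (mkParams L Dsq N m).η t (k + 1) = 4 * L * Dsq t / N t := by
    simp only [mkParams]; push_cast; field_simp; ring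
  rw [e] at key
  have e2 : ((k + 1 : ℕ) : ℝ) * (((k + 1 : ℕ) : ℝ) + 1) = (k + 1) * (k + 2) := by
    push_cast; ring
  rw [potential, e2]
  exact key

end Step

/-! ### One outer iteration in expectation, and halving of the gap -/

section Round

variable {d n : ℕ} {L D : ℝ} {K : Set (Vec d)} {F : Fin n → Vec d → ℝ} {lmo : Vec d → Vec d}
  {ws x₀ : Vec d} {Dsq : ℕ → ℝ} {N : ℕ → ℕ} {m : ℕ → ℕ → ℕ}
  {S : Type*} [MeasurableSpace S] {P : Measure S} [IsProbabilityMeasure P]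
  {ξ : ℕ × ℕ × ℕ → S → Fin n}

theorem Problem.runAt_mem (h : Problem L D K F lmo ws) (t : ℕ) (ω : ℕ × ℕ × ℕ → Fin n) :
    (runAt (mkParams L Dsq N m) K F lmo x₀ t ω).w ∈ K := h.run_mem _ _ _

theorem Problem.innerAt_mem (h : Problem L D K F lmo ws) (t k : ℕ) (ω : ℕ × ℕ × ℕ → Fin n) :
    (innerAt (mkParams L Dsq N m) K F lmo x₀ t k ω).x ∈ K ∧
      (innerAt (mkParams L Dsq N m) K F lmo x₀ t k ω).y ∈ K :=
  h.innerLoop_mem (h.runAt_mem t ω) _ _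

/-- The error of the averaged stochastic gradient of iteration `k + 1` of round `t + 1`. -/
noncomputable def errAt (p : Params) (K : Set (Vec d)) (F : Fin n → Vec d → ℝ)
    (lmo : Vec d → Vec d) (x₀ : Vec d) (t k : ℕ) (ω : ℕ × ℕ × ℕ → Fin n) : Vec d :=
  batchErr F (runAt p K F lmo x₀ t ω).w (extrapolate k (innerAt p K F lmo x₀ t k ω))
    (p.m (t + 1) (k + 1)) (fun j => ω (t + 1, k + 1, j))

/-- The error of a single stochastic gradient of iteration `k + 1` of round `t + 1`. -/
noncomputable def vrErrAt (p : Params) (K : Set (Vec d)) (F : Fin n → Vec d → ℝ)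
    (lmo : Vec d → Vec d) (x₀ : Vec d) (t k : ℕ) (ω : ℕ × ℕ × ℕ → Fin n) : Fin n → Vec d :=
  vrErr F (runAt p K F lmo x₀ t ω).w (extrapolate k (innerAt p K F lmo x₀ t k ω))

section Errors

variable (p : Params) (K : Set (Vec d)) (F : Fin n → Vec d → ℝ) (lmo : Vec d → Vec d)
  (x₀ : Vec d) (t k : ℕ)

theorem finDep_vrErrAt : FinDep (vrErrAt p K F lmo x₀ t k) :=
  (finDep_runAt p K F lmo x₀ t).comp₂ (finDep_innerAt p K F lmo x₀ t k)
    fun s s' => vrErr F s.w (extrapolate k s')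

theorem free_vrErrAt (j : ℕ) : Free (t + 1, k + 1, j) (vrErrAt p K F lmo x₀ t k) := fun ω i => by
  rw [vrErrAt, free_runAt p K F lmo x₀ t, free_innerAt p K F lmo x₀ t k j]
  rfl

theorem finDep_vrErrAt_sample (j : ℕ) :
    FinDep fun ω => vrErrAt p K F lmo x₀ t k ω (ω (t + 1, k + 1, j)) :=
  (finDep_vrErrAt p K F lmo x₀ t k).comp₂ (finDep_apply (t + 1, k + 1, j)) fun f i => f i

theorem finDep_errAt : FinDep (errAt p K F lmo x₀ t k) :=
  (FinDep.sum (Finset.range (p.m (t + 1) (k + 1))) fun j _ =>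
    finDep_vrErrAt_sample p K F lmo x₀ t k j).comp fun v => (1 / (p.m (t + 1) (k + 1) : ℝ)) • v

variable {p K F lmo x₀ t k}

theorem mean_norm_errAt_sq (hξ : UniformSamples P ξ) (hn : 0 < n)
    (hF : ∀ i, Differentiable ℝ (F i)) (hm : 0 < p.m (t + 1) (k + 1)) :
    mean P ξ (fun ω => ‖errAt p K F lmo x₀ t k ω‖ ^ 2) = (1 / (p.m (t + 1) (k + 1) : ℝ))
      * mean P ξ (fun ω => (1 / (n : ℝ)) * ∑ i, ‖vrErrAt p K F lmo x₀ t k ω i‖ ^ 2) :=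
  mean_norm_batch_sq hξ hm (a := fun j => (t + 1, k + 1, j)) (fun i j hij => by simpa using hij)
    (finDep_vrErrAt p K F lmo x₀ t k) (free_vrErrAt p K F lmo x₀ t k)
    fun _ => sum_vrErr hn hF _ _

theorem mean_inner_errAt (hξ : UniformSamples P ξ) (hn : 0 < n)
    (hF : ∀ i, Differentiable ℝ (F i)) (ws : Vec d) :
    mean P ξ (fun ω => inner ℝ (errAt p K F lmo x₀ t k ω)
      ((innerAt p K F lmo x₀ t k ω).x - ws)) = 0 := by
  have hu : FinDep fun ω => (innerAt p K F lmo x₀ t k ω).x - ws :=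
    (finDep_innerAt p K F lmo x₀ t k).comp fun s => s.x - ws
  have hexp : ∀ ω, (inner ℝ (errAt p K F lmo x₀ t k ω) ((innerAt p K F lmo x₀ t k ω).x - ws) : ℝ)
      = (1 / (p.m (t + 1) (k + 1) : ℝ)) * ∑ j ∈ Finset.range (p.m (t + 1) (k + 1)),
        inner ℝ (vrErrAt p K F lmo x₀ t k ω (ω (t + 1, k + 1, j)))
          ((innerAt p K F lmo x₀ t k ω).x - ws) := fun ω => by
    rw [errAt, batchErr, real_inner_smul_left, sum_inner]
    rfl
  simp only [hexp]
  rw [mean_const_mul, mean_sum hξ, Finset.sum_eq_zero, mul_zero]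
  · intro j _
    refine mean_inner_eq_zero hξ (finDep_vrErrAt p K F lmo x₀ t k) hu
      (free_vrErrAt p K F lmo x₀ t k j) (fun ω i => ?_) fun _ => sum_vrErr hn hF _ _
    simp only [free_innerAt p K F lmo x₀ t k j ω i]
  · intro j _
    exact (finDep_vrErrAt_sample p K F lmo x₀ t k j).comp₂ hu fun x y => (inner ℝ x y : ℝ)

end Errors

theorem Problem.mean_potential_succ_le (h : Problem L D K F lmo ws) (hξ : UniformSamples P ξ)
    {t k : ℕ} (hQ : 0 < Dsq (t + 1)) (hN : 0 < N (t + 1)) (hm : 0 < m (t + 1) (k + 1)) :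
    mean P ξ (fun ω => potential L F ws (k + 1)
        (innerAt (mkParams L Dsq N m) K F lmo x₀ t (k + 1) ω))
      ≤ mean P ξ (fun ω => potential L F ws k (innerAt (mkParams L Dsq N m) K F lmo x₀ t k ω))
        + 4 * L * Dsq (t + 1) / N (t + 1)
        + (k + 1) ^ 2 / L * mean P ξ (fun ω => ‖errAt (mkParams L Dsq N m) K F lmo x₀ t k ω‖ ^ 2)
    := by
  set p := mkParams L Dsq N m with hp
  have hS := finDep_innerAt p K F lmo x₀ t
  have hE := finDep_errAt p K F lmo x₀ t k
  have h1 : FinDep fun ω => potential L F ws k (innerAt p K F lmo x₀ t k ω) := (hS k).comp _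
  have h2 : FinDep fun ω => potential L F ws (k + 1) (innerAt p K F lmo x₀ t (k + 1) ω) :=
    (hS (k + 1)).comp _
  have h3 : FinDep fun ω => ((k : ℝ) + 1) ^ 2 / L * ‖errAt p K F lmo x₀ t k ω‖ ^ 2 :=
    hE.comp fun e => ((k : ℝ) + 1) ^ 2 / L * ‖e‖ ^ 2
  have h4 : FinDep fun ω => 2 * ((k : ℝ) + 1) * inner ℝ (errAt p K F lmo x₀ t k ω)
      ((innerAt p K F lmo x₀ t k ω).x - ws) :=
    hE.comp₂ (hS k) fun e s => 2 * ((k : ℝ) + 1) * inner ℝ e (s.x - ws)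
  have h5 : FinDep fun _ : ℕ × ℕ × ℕ → Fin n => 4 * L * Dsq (t + 1) / N (t + 1) := finDep_const _
  have h15 := h1.comp₂ h5 (· + ·)
  have h153 := h15.comp₂ h3 (· + ·)
  refine (mean_mono hξ h2 (h153.comp₂ h4 (· + ·)) fun ω => ?_).trans (le_of_eq ?_)
  · exact h.potential_innerStep_le hQ hN _ k hm _ (h.innerAt_mem t k ω).1
  · rw [mean_add hξ h153 h4, mean_add hξ h15 h3, mean_add hξ h1 h5, mean_const, mean_const_mul,
      mean_const_mul, mean_inner_errAt hξ h.n_pos (fun i => (h.smooth i).differentiable)]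
    ring

/-- Since `γ₁ = 1` and `x₀ = y₀`, the first extrapolated point is the snapshot, where variance
reduction is exact. This iteration is separate because `Φ_0` says nothing about the gap at `y₀`. -/
theorem errAt_zero (p : Params) (K : Set (Vec d)) (F : Fin n → Vec d → ℝ)
    (lmo : Vec d → Vec d) (x₀ : Vec d) (t : ℕ) (ω : ℕ × ℕ × ℕ → Fin n) :
    errAt p K F lmo x₀ t 0 ω = 0 := by
  have hz : extrapolate 0 (innerAt p K F lmo x₀ t 0 ω) = (runAt p K F lmo x₀ t ω).w := by
    simp only [extrapolate, innerAt, innerLoop]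
    module
  simp [errAt, batchErr, hz, vrErr_self]

theorem Problem.mean_norm_errAt_sq_le (h : Problem L D K F lmo ws) (hξ : UniformSamples P ξ)
    {t k : ℕ} (hm : 0 < m (t + 1) (k + 1)) :
    mean P ξ (fun ω => ‖errAt (mkParams L Dsq N m) K F lmo x₀ t k ω‖ ^ 2)
      ≤ (1 / (m (t + 1) (k + 1) : ℝ)) * (3 * (L ^ 2 * ((2 / ((k : ℝ) + 2)) ^ 2
          * mean P ξ (fun ω => ‖(innerAt (mkParams L Dsq N m) K F lmo x₀ t k ω).x
            - (innerAt (mkParams L Dsq N m) K F lmo x₀ t k ω).y‖ ^ 2))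
        + 2 * L * mean P ξ
          (fun ω => avg F (innerAt (mkParams L Dsq N m) K F lmo x₀ t k ω).y - avg F ws)
        + 2 * L * mean P ξ
          (fun ω => avg F (runAt (mkParams L Dsq N m) K F lmo x₀ t ω).w - avg F ws))) := by
  set p := mkParams L Dsq N m with hp
  have hS := finDep_innerAt p K F lmo x₀ t k
  have hR := finDep_runAt p K F lmo x₀ t
  rw [mean_norm_errAt_sq hξ h.n_pos (fun i => (h.smooth i).differentiable) hm]
  have h0 : FinDep fun ω => (1 / (n : ℝ)) * ∑ i, ‖vrErrAt p K F lmo x₀ t k ω i‖ ^ 2 :=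
    (finDep_vrErrAt p K F lmo x₀ t k).comp fun f => (1 / (n : ℝ)) * ∑ i, ‖f i‖ ^ 2
  have h1 : FinDep fun ω => 3 * (L ^ 2 * (2 / ((k : ℝ) + 2)) ^ 2) *
      ‖(innerAt p K F lmo x₀ t k ω).x - (innerAt p K F lmo x₀ t k ω).y‖ ^ 2 :=
    hS.comp fun s => 3 * (L ^ 2 * (2 / ((k : ℝ) + 2)) ^ 2) * ‖s.x - s.y‖ ^ 2
  have h2 : FinDep fun ω => 3 * (2 * L) * (avg F (innerAt p K F lmo x₀ t k ω).y - avg F ws) :=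
    hS.comp fun s => 3 * (2 * L) * (avg F s.y - avg F ws)
  have h3 : FinDep fun ω => 3 * (2 * L) * (avg F (runAt p K F lmo x₀ t ω).w - avg F ws) :=
    hR.comp fun s => 3 * (2 * L) * (avg F s.w - avg F ws)
  have h12 := h1.comp₂ h2 (· + ·)
  have hm' : (mkParams L Dsq N m).m (t + 1) (k + 1) = m (t + 1) (k + 1) := rfl
  rw [hp, hm', ← hp]
  refine mul_le_mul_of_nonneg_left ?_ (by positivity)
  refine (mean_mono hξ h0 (h12.comp₂ h3 (· + ·)) fun ω => ?_).trans (le_of_eq ?_)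
  · have hmem := h.innerAt_mem (x₀ := x₀) (Dsq := Dsq) (N := N) (m := m) t k ω
    rw [← hp] at hmem
    refine (avg_norm_vrErr_sq_le h.L_pos h.n_pos h.smooth h.convex h.mem h.isMin
      (h.runAt_mem t ω) hmem.2 _).trans (le_of_eq ?_)
    have e : extrapolate k (innerAt p K F lmo x₀ t k ω) - (innerAt p K F lmo x₀ t k ω).y
        = (2 / ((k : ℝ) + 2)) • ((innerAt p K F lmo x₀ t k ω).x
          - (innerAt p K F lmo x₀ t k ω).y) := by
      have : ((k + 1 : ℕ) : ℝ) + 1 = (k : ℝ) + 2 := by push_cast; ring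
      rw [extrapolate, this]
      module
    rw [e, norm_smul, mul_pow, Real.norm_eq_abs, sq_abs]
    ring
  · rw [mean_add hξ h12 h3, mean_add hξ h1 h2, mean_const_mul, mean_const_mul, mean_const_mul]
    ring

/-- `X`, `Y`, `Z` stand for the means of `‖x-y‖²`, `gap(y)` and `gap(y₀)`. The factor `(k+1)²` is
absorbed by `(2/(k+2))²` in the first, by `(k+1)² ≤ 2k(k+1)` in the second, and by `k+1 ≤ N` in the
third; `hmb` is the resulting demand on the batch size. -/
theorem variance_term_le {L Q N m k X Xb Y Z R : ℝ} (hL : 0 < L) (hN : 0 < N)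
    (hm : 0 < m) (hk : 1 ≤ k) (hkN : k + 1 ≤ N) (hX0 : 0 ≤ X) (hX : X ≤ Xb) (hY0 : 0 ≤ Y)
    (hY : k * (k + 1) * Y ≤ 8 * L * Q) (hZ0 : 0 ≤ Z) (hZ : Z ≤ R)
    (hmb : 3 * N * (4 * L ^ 2 * Xb + 32 * L ^ 2 * Q + 2 * L * R * N ^ 2) ≤ m * (L ^ 2 * Q)) :
    (k + 1) ^ 2 / L * ((1 / m) * (3 * (L ^ 2 * ((2 / (k + 2)) ^ 2 * X) + 2 * L * Y + 2 * L * Z)))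
      ≤ L * Q / N := by
  have h1 : (k + 1) ^ 2 * ((2 / (k + 2)) ^ 2 * X) ≤ 4 * Xb := by
    have : ((k + 1) * (2 / (k + 2))) ^ 2 ≤ 2 ^ 2 := by
      gcongr
      rw [mul_div_assoc', div_le_iff₀ (by linarith)]
      linarith
    calc (k + 1) ^ 2 * ((2 / (k + 2)) ^ 2 * X) = ((k + 1) * (2 / (k + 2))) ^ 2 * X := by ring
      _ ≤ 2 ^ 2 * Xb := by gcongr
      _ = 4 * Xb := by ring
  have h2 : (k + 1) ^ 2 * Y ≤ 16 * L * Q := by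
    have : (k + 1) ^ 2 * Y ≤ 2 * (k * (k + 1) * Y) := by
      have : 0 ≤ (k + 1) * (k - 1) * Y :=
        mul_nonneg (mul_nonneg (by linarith) (by linarith)) hY0
      nlinarith
    linarith
  have h3 : (k + 1) ^ 2 * Z ≤ N ^ 2 * R := by gcongr
  have h4 : (k + 1) ^ 2 * (L ^ 2 * ((2 / (k + 2)) ^ 2 * X) + 2 * L * Y + 2 * L * Z)
      ≤ 4 * L ^ 2 * Xb + 32 * L ^ 2 * Q + 2 * L * R * N ^ 2 := by
    have e1 := mul_le_mul_of_nonneg_left h1 (sq_nonneg L)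
    have e2 := mul_le_mul_of_nonneg_left h2 hL.le
    have e3 := mul_le_mul_of_nonneg_left h3 hL.le
    linarith
  have h5 := (mul_le_mul_of_nonneg_left h4 (by positivity : 0 ≤ 3 * N)).trans hmb
  rw [le_div_iff₀ hN]
  have e : (k + 1) ^ 2 / L
      * ((1 / m) * (3 * (L ^ 2 * ((2 / (k + 2)) ^ 2 * X) + 2 * L * Y + 2 * L * Z))) * N
      = (1 / (L * m)) * (3 * N
        * ((k + 1) ^ 2 * (L ^ 2 * ((2 / (k + 2)) ^ 2 * X) + 2 * L * Y + 2 * L * Z))) := by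
    field_simp
  rw [e]
  refine (mul_le_mul_of_nonneg_left h5 (by positivity)).trans (le_of_eq ?_)
  field_simp

/-- Growth of the expected potential along one round. -/
theorem Problem.mean_potential_le (h : Problem L D K F lmo ws) (hξ : UniformSamples P ξ)
    {t : ℕ} {R B b : ℝ} (hQ : 0 < Dsq (t + 1)) (hN : 0 < N (t + 1)) (hb : 0 ≤ b)
    (hm : ∀ k, 0 < m (t + 1) (k + 1))
    (hR : mean P ξ (fun ω => avg F (runAt (mkParams L Dsq N m) K F lmo x₀ t ω).w - avg F ws) ≤ R)
    (hdist : mean P ξ (fun ω => ‖(runAt (mkParams L Dsq N m) K F lmo x₀ t ω).w - ws‖ ^ 2)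
      ≤ Dsq (t + 1))
    (hxy : ∀ x ∈ K, ∀ y ∈ K,
      ‖x - y‖ ^ 2 ≤ B + b * (3 * L * ‖x - ws‖ ^ 2 + 2 * (avg F y - avg F ws)))
    (hmb : ∀ k, 3 * N (t + 1) * (4 * L ^ 2 * (B + b * (8 * L * Dsq (t + 1)))
      + 32 * L ^ 2 * Dsq (t + 1) + 2 * L * R * N (t + 1) ^ 2)
      ≤ m (t + 1) (k + 1) * (L ^ 2 * Dsq (t + 1))) :
    ∀ k ≤ N (t + 1),
      mean P ξ (fun ω => potential L F ws k (innerAt (mkParams L Dsq N m) K F lmo x₀ t k ω))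
        ≤ 3 * L * Dsq (t + 1) + k * (5 * L * Dsq (t + 1) / N (t + 1)) := by
  intro k
  set p := mkParams L Dsq N m with hp
  have hL := h.L_pos
  have hN' : (0 : ℝ) < N (t + 1) := by exact_mod_cast hN
  set Q := Dsq (t + 1) with hQdef
  induction k with
  | zero =>
    intro _
    have : ∀ ω, potential L F ws 0 (innerAt p K F lmo x₀ t 0 ω)
        = 3 * L * ‖(runAt p K F lmo x₀ t ω).w - ws‖ ^ 2 := fun ω => by
      simp [potential, innerAt, innerLoop]
    simp only [this, mean_const_mul]
    have := mul_le_mul_of_nonneg_left hdist (show 0 ≤ 3 * L by positivity)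
    simpa using this
  | succ k ih =>
    intro hk
    have ih := ih (by lia)
    have hkN : (k : ℝ) + 1 ≤ N (t + 1) := by exact_mod_cast hk
    have hstep := h.mean_potential_succ_le (x₀ := x₀) (N := N) (Dsq := Dsq) hξ hQ hN (hm k)
    -- The share `4LQ/N` is the subproblem tolerance, and `LQ/N` is the allowance for the variance.
    have e4 : 4 * L * Q / (N (t + 1) : ℝ) + L * Q / N (t + 1) = 5 * L * Q / N (t + 1) := by ring
    suffices hvar : ((k : ℝ) + 1) ^ 2 / L * mean P ξ (fun ω => ‖errAt p K F lmo x₀ t k ω‖ ^ 2)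
        ≤ L * Q / N (t + 1) by
      push_cast
      linarith
    rcases Nat.eq_zero_or_pos k with rfl | hkpos
    · simp only [errAt_zero, norm_zero, ne_eq, OfNat.ofNat_ne_zero, not_false_eq_true, zero_pow,
        mean_const, mul_zero]
      positivity
    have hk1 : (1 : ℝ) ≤ k := by exact_mod_cast hkpos
    have hS := finDep_innerAt p K F lmo x₀ t k
    have hmem := fun ω => h.innerAt_mem (x₀ := x₀) (Dsq := Dsq) (N := N) (m := m) t k ω
    rw [← hp] at hmem
    have hpot : mean P ξ (fun ω => potential L F ws k (innerAt p K F lmo x₀ t k ω))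
        ≤ 8 * L * Q := by
      have : (k : ℝ) * (5 * L * Q / N (t + 1)) ≤ 5 * L * Q := by
        rw [mul_div_assoc', div_le_iff₀ hN', mul_comm]
        gcongr
        linarith
      linarith
    have hpotD : FinDep fun ω => potential L F ws k (innerAt p K F lmo x₀ t k ω) := hS.comp _
    have hX : mean P ξ (fun ω => ‖(innerAt p K F lmo x₀ t k ω).x
        - (innerAt p K F lmo x₀ t k ω).y‖ ^ 2) ≤ B + b * (8 * L * Q) := by
      have hb' : FinDep fun ω => b * potential L F ws k (innerAt p K F lmo x₀ t k ω) :=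
        hpotD.comp (b * ·)
      have h1 : mean P ξ (fun ω => ‖(innerAt p K F lmo x₀ t k ω).x
          - (innerAt p K F lmo x₀ t k ω).y‖ ^ 2)
          ≤ mean P ξ fun ω => B + b * potential L F ws k (innerAt p K F lmo x₀ t k ω) := by
        refine mean_mono hξ (hS.comp fun s => ‖s.x - s.y‖ ^ 2)
          ((finDep_const B).comp₂ hb' (· + ·)) fun ω => ?_
        refine (hxy _ (hmem ω).1 _ (hmem ω).2).trans ?_
        have hg := h.gap_nonneg (hmem ω).2
        -- As `k ≥ 1`, the bracket in `hxy` is at most the potential.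
        have : (2 : ℝ) ≤ k * (k + 1) := by nlinarith
        have := mul_le_mul_of_nonneg_right this hg
        refine add_le_add_right (mul_le_mul_of_nonneg_left ?_ hb) B
        unfold potential
        linarith
      rw [mean_add hξ (finDep_const B) hb', mean_const, mean_const_mul] at h1
      have := mul_le_mul_of_nonneg_left hpot hb
      linarith
    have hY : (k : ℝ) * (k + 1) * mean P ξ (fun ω => avg F (innerAt p K F lmo x₀ t k ω).y
        - avg F ws) ≤ 8 * L * Q := by
      rw [← mean_const_mul]
      refine le_trans (mean_mono hξ (hS.comp fun s => (k : ℝ) * (k + 1) * (avg F s.y - avg F ws))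
        hpotD fun ω => ?_) hpot
      unfold potential
      have : 0 ≤ 3 * L * ‖(innerAt p K F lmo x₀ t k ω).x - ws‖ ^ 2 := by positivity
      linarith
    have hm' : (0 : ℝ) < m (t + 1) (k + 1) := by exact_mod_cast hm k
    refine (mul_le_mul_of_nonneg_left (h.mean_norm_errAt_sq_le hξ (hm k)) (by positivity)).trans ?_
    exact variance_term_le hL hN' hm' hk1 hkN
      (integral_nonneg fun _ => by positivity) hX
      (integral_nonneg fun _ => h.gap_nonneg (hmem _).2) hY
      (integral_nonneg fun _ => h.gap_nonneg (h.runAt_mem _ _)) hR (hmb k)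

/-- Expected accuracy after one round. -/
theorem Problem.mean_gap_succ_le (h : Problem L D K F lmo ws) (hξ : UniformSamples P ξ)
    {t : ℕ} {R B b : ℝ} (hQ : 0 < Dsq (t + 1)) (hN : 0 < N (t + 1)) (hb : 0 ≤ b)
    (hm : ∀ k, 0 < m (t + 1) (k + 1))
    (hR : mean P ξ (fun ω => avg F (runAt (mkParams L Dsq N m) K F lmo x₀ t ω).w - avg F ws) ≤ R)
    (hdist : mean P ξ (fun ω => ‖(runAt (mkParams L Dsq N m) K F lmo x₀ t ω).w - ws‖ ^ 2)
      ≤ Dsq (t + 1))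
    (hxy : ∀ x ∈ K, ∀ y ∈ K,
      ‖x - y‖ ^ 2 ≤ B + b * (3 * L * ‖x - ws‖ ^ 2 + 2 * (avg F y - avg F ws)))
    (hmb : ∀ k, 3 * N (t + 1) * (4 * L ^ 2 * (B + b * (8 * L * Dsq (t + 1)))
      + 32 * L ^ 2 * Dsq (t + 1) + 2 * L * R * N (t + 1) ^ 2)
      ≤ m (t + 1) (k + 1) * (L ^ 2 * Dsq (t + 1))) :
    (N (t + 1) : ℝ) ^ 2
        * mean P ξ (fun ω => avg F (runAt (mkParams L Dsq N m) K F lmo x₀ (t + 1) ω).w - avg F ws)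
      ≤ 8 * L * Dsq (t + 1) := by
  have key := h.mean_potential_le hξ hQ hN hb hm hR hdist hxy hmb (N (t + 1)) le_rfl
  have hL := h.L_pos
  have hN' : (0 : ℝ) < N (t + 1) := by exact_mod_cast hN
  have e : (N (t + 1) : ℝ) * (5 * L * Dsq (t + 1) / N (t + 1)) = 5 * L * Dsq (t + 1) := by
    field_simp
  rw [e] at key
  rw [← mean_const_mul]
  refine le_trans (mean_mono hξ ((finDep_runAt _ K F lmo x₀ (t + 1)).comp fun s =>
    (N (t + 1) : ℝ) ^ 2 * (avg F s.w - avg F ws)) ((finDep_innerAt _ K F lmo x₀ t _).comp _)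
    fun ω => ?_) (key.trans (by linarith))
  have hg := h.gap_nonneg (h.runAt_mem (x₀ := x₀) (Dsq := Dsq) (N := N) (m := m) (t + 1) ω)
  rw [runAt_succ_w] at hg ⊢
  have h1 : 0 ≤ 3 * L * ‖(innerAt (mkParams L Dsq N m) K F lmo x₀ t (N (t + 1)) ω).x - ws‖ ^ 2 := by
    positivity
  have h2 := mul_nonneg hN'.le hg
  unfold potential
  change _ * (avg F (innerAt (mkParams L Dsq N m) K F lmo x₀ t (N (t + 1)) ω).y - avg F ws) ≤ _
  change 0 ≤ _ * (avg F (innerAt (mkParams L Dsq N m) K F lmo x₀ t (N (t + 1)) ω).y - avg F ws)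
    at h2
  linarith

/-- A full step to the oracle point: smoothness bounds `f` there by its linear model at `x₀` plus `L
D²/2`, the oracle compares that model with its value at `w*`, and convexity puts the latter below
`f(w*)`. -/
theorem Problem.gap_initial_le (h : Problem L D K F lmo ws) {x₀ : Vec d} (hx₀ : x₀ ∈ K) :
    avg F (lmo (gradient (avg F) x₀)) - avg F ws ≤ L * D ^ 2 / 2 := by
  have hf := avg_convexSmooth h.n_pos h.smooth
  have hL := h.L_pos
  set v := lmo (gradient (avg F) x₀) with hv
  have h1 := hf.upper v x₀
  have h2 := hf.lower ws x₀
  have h3 : inner ℝ (gradient (avg F) x₀) v ≤ inner ℝ (gradient (avg F) x₀) ws :=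
    (h.isLMO _).2 ws h.mem
  have h4 : ‖v - x₀‖ ^ 2 ≤ D ^ 2 := by
    have := h.norm_sub_le v (h.isLMO _).1 x₀ hx₀
    gcongr
  rw [inner_sub_right] at h1 h2
  have h5 : L / 2 * ‖v - x₀‖ ^ 2 ≤ L / 2 * D ^ 2 := by gcongr
  linarith

/-- The expected gap is halved in every round. -/
theorem Problem.mean_gap_le (h : Problem L D K F lmo ws) (hξ : UniformSamples P ξ) (hx₀ : x₀ ∈ K)
    {B b q₀ q₁ : ℝ} (hQ : ∀ t, 0 < Dsq t) (hN : ∀ t, 0 < N t) (hb : 0 ≤ b)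
    (hm : ∀ t k, 0 < m t k) (hq₁ : 0 ≤ q₁)
    (hdist : ∀ w ∈ K, ‖w - ws‖ ^ 2 ≤ q₀ + q₁ * (avg F w - avg F ws))
    (hDsq : ∀ t : ℕ, q₀ + q₁ * (L * D ^ 2 / 2 ^ (t + 1)) ≤ Dsq (t + 1))
    (hxy : ∀ x ∈ K, ∀ y ∈ K,
      ‖x - y‖ ^ 2 ≤ B + b * (3 * L * ‖x - ws‖ ^ 2 + 2 * (avg F y - avg F ws)))
    (hmb : ∀ t k : ℕ, 3 * N (t + 1) * (4 * L ^ 2 * (B + b * (8 * L * Dsq (t + 1)))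
      + 32 * L ^ 2 * Dsq (t + 1) + 2 * L * (L * D ^ 2 / 2 ^ (t + 1)) * N (t + 1) ^ 2)
      ≤ m (t + 1) (k + 1) * (L ^ 2 * Dsq (t + 1)))
    (hNsq : ∀ t : ℕ, 8 * L * Dsq (t + 1) ≤ (N (t + 1) : ℝ) ^ 2 * (L * D ^ 2 / 2 ^ (t + 2)))
    (t : ℕ) :
    mean P ξ (fun ω => avg F (runAt (mkParams L Dsq N m) K F lmo x₀ t ω).w - avg F ws)
      ≤ L * D ^ 2 / 2 ^ (t + 1) := by
  induction t with
  | zero =>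
    simp only [runAt, run, mean_const, zero_add, pow_one]
    exact h.gap_initial_le hx₀
  | succ t ih =>
    have hR := finDep_runAt (mkParams L Dsq N m) K F lmo x₀ t
    have hd : mean P ξ (fun ω => ‖(runAt (mkParams L Dsq N m) K F lmo x₀ t ω).w - ws‖ ^ 2)
        ≤ Dsq (t + 1) := by
      have hg : FinDep fun ω =>
          q₁ * (avg F (runAt (mkParams L Dsq N m) K F lmo x₀ t ω).w - avg F ws) :=
        hR.comp fun s => q₁ * (avg F s.w - avg F ws)
      have h1 := mean_mono hξ (hR.comp fun s => ‖s.w - ws‖ ^ 2)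
        ((finDep_const q₀).comp₂ hg (· + ·)) fun ω => hdist _ (h.runAt_mem t ω)
      rw [mean_add hξ (finDep_const q₀) hg, mean_const, mean_const_mul] at h1
      have h2 := mul_le_mul_of_nonneg_left ih hq₁
      linarith [hDsq t]
    have key := h.mean_gap_succ_le hξ (hQ _) (hN _) hb (fun k => hm _ _) ih hd hxy (hmb t)
    have hN' : (0 : ℝ) < (N (t + 1) : ℝ) ^ 2 := by
      have : (0 : ℝ) < N (t + 1) := by exact_mod_cast hN _
      positivity
    exact le_of_mul_le_mul_left (key.trans (hNsq t)) hN'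

end Round

/-! ### Number of rounds, rounding errors and geometric sums -/

section Numerics

theorem exists_rounds {X : ℝ} (hX : 2 ≤ X) :
    ∃ T : ℕ, X ≤ 2 ^ T ∧ (2 : ℝ) ^ T ≤ 2 * X ∧ (T : ℝ) + 1 ≤ 6 * Real.log X := by
  have hX0 : 0 < X := by linarith
  have hlog2 := Real.log_two_gt_d9
  have hlog : Real.log 2 ≤ Real.log X := Real.log_le_log (by norm_num) hX
  set a := Real.logb 2 X with ha
  have hal : a * Real.log 2 = Real.log X := by
    rw [ha, Real.logb]; field_simp
  have ha1 : 1 ≤ a := by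
    rw [ha, Real.logb, le_div_iff₀ (by linarith)]; linarith
  have hXa : (2 : ℝ) ^ a = X := Real.rpow_logb (by norm_num) (by norm_num) hX0
  have h1 : a ≤ ⌈a⌉₊ := Nat.le_ceil a
  have h2 : (⌈a⌉₊ : ℝ) < a + 1 := Nat.ceil_lt_add_one (by linarith)
  -- As `a = log₂ X ≥ 1`, one has `⌈a⌉ + 1 ≤ 3a = 3 log X / log 2 ≤ 6 log X`.
  refine ⟨⌈a⌉₊, ?_, ?_, ?_⟩
  · rw [← Real.rpow_natCast]
    conv_lhs => rw [← hXa]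
    exact Real.rpow_le_rpow_of_exponent_le (by norm_num) h1
  · rw [← Real.rpow_natCast]
    calc (2 : ℝ) ^ ((⌈a⌉₊ : ℕ) : ℝ) ≤ 2 ^ (a + 1) :=
          Real.rpow_le_rpow_of_exponent_le (by norm_num) h2.le
      _ = 2 * X := by rw [Real.rpow_add (by norm_num), hXa, Real.rpow_one, mul_comm]
  · nlinarith

theorem sum_pow_succ_le {ρ : ℝ} (hρ : 2 ≤ ρ) (T : ℕ) :
    ∑ t ∈ Finset.range T, ρ ^ (t + 1) ≤ 2 * ρ ^ T := by
  induction T with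
  | zero => simp
  | succ T ih =>
    rw [Finset.sum_range_succ]
    have : 2 * ρ ^ T ≤ ρ ^ (T + 1) := by
      rw [pow_succ, mul_comm]
      exact mul_le_mul_of_nonneg_left hρ (by positivity)
    linarith

theorem growingN_pos (t : ℕ) : 0 < growingN t := Nat.ceil_pos.2 (by positivity)

theorem growingN_sq (t : ℕ) :
    16 * 2 ^ t ≤ (growingN t : ℝ) ^ 2 ∧ (growingN t : ℝ) ^ 2 ≤ 25 * 2 ^ t := by
  set a : ℝ := (2 : ℝ) ^ ((t : ℝ) / 2 + 2) with ha
  have ha2 : a ^ 2 = 16 * 2 ^ t := by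
    rw [ha, ← Real.rpow_natCast, ← Real.rpow_mul (by norm_num)]
    have : ((t : ℝ) / 2 + 2) * (2 : ℕ) = ((t + 4 : ℕ) : ℝ) := by push_cast; ring
    rw [this, Real.rpow_natCast, pow_add]
    norm_num [mul_comm]
  have ha0 : 0 < a := by positivity
  have ha4 : 4 ≤ a := by
    have : (1 : ℝ) ≤ 2 ^ t := one_le_pow₀ (by norm_num)
    nlinarith
  have h1 : a ≤ growingN t := Nat.le_ceil a
  have h2 : (growingN t : ℝ) ≤ 5 / 4 * a := by
    have : (growingN t : ℝ) < a + 1 := Nat.ceil_lt_add_one ha0.le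
    linarith
  constructor
  · rw [← ha2]; gcongr
  · calc (growingN t : ℝ) ^ 2 ≤ (5 / 4 * a) ^ 2 := by gcongr
      _ = 25 * 2 ^ t := by rw [mul_pow, ha2]; ring

/-- Here `√8 = 2^(3/2)`. Cubes arise in case (b), where the batch term proportional to `N_t (k+1)`
is summed over `k ≤ N_t`; they lead to the `ε^(-3/2)` cost. -/
theorem growingN_cube_le (t : ℕ) : (growingN t : ℝ) ^ 3 ≤ 125 * √8 ^ t := by
  refine le_of_sq_le_sq ?_ (by positivity)
  calc ((growingN t : ℝ) ^ 3) ^ 2 = ((growingN t : ℝ) ^ 2) ^ 3 := by ring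
    _ ≤ (25 * 2 ^ t) ^ 3 := by gcongr; exact (growingN_sq t).2
    _ = (125 * √8 ^ t) ^ 2 := by
      have h8 : ((√8) ^ t) ^ 2 = (2 ^ t : ℝ) ^ 3 := by
        rw [← pow_mul, mul_comm t 2, pow_mul, Real.sq_sqrt (by norm_num), ← pow_mul,
          mul_comm t 3, pow_mul]
        norm_num
      rw [mul_pow, mul_pow, h8]
      norm_num

theorem sqrt_eight_pow_le {X : ℝ} (hX : 0 ≤ X) {T : ℕ} (hT : (2 : ℝ) ^ T ≤ 2 * X) :
    √8 ^ T ≤ 3 * (X * √X) := by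
  refine le_of_sq_le_sq ?_ (by positivity)
  have h8 : ((√8) ^ T) ^ 2 = (2 ^ T : ℝ) ^ 3 := by
    rw [← pow_mul, mul_comm T 2, pow_mul, Real.sq_sqrt (by norm_num), ← pow_mul,
      mul_comm T 3, pow_mul]
    norm_num
  have h9 : (3 * (X * √X)) ^ 2 = 9 * X ^ 3 := by
    rw [mul_pow, mul_pow, Real.sq_sqrt hX]; ring
  rw [h8, h9]
  calc ((2 : ℝ) ^ T) ^ 3 ≤ (2 * X) ^ 3 := by gcongr
    _ = 8 * X ^ 3 := by ring
    _ ≤ 9 * X ^ 3 := by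
      have : 0 ≤ X ^ 3 := by positivity
      linarith

theorem ceil_sqrt_sq {μ : ℝ} (hμ : 1 ≤ μ) :
    32 * μ ≤ (⌈√(32 * μ)⌉₊ : ℝ) ^ 2 ∧ (⌈√(32 * μ)⌉₊ : ℝ) ^ 2 ≤ 47 * μ := by
  set a := √(32 * μ) with ha
  have ha0 : 0 ≤ a := Real.sqrt_nonneg _
  have ha2 : a ^ 2 = 32 * μ := Real.sq_sqrt (by linarith)
  have ha5 : 5 ≤ a := by nlinarith
  have h1 : a ≤ ⌈a⌉₊ := Nat.le_ceil a
  have h2 : (⌈a⌉₊ : ℝ) ≤ 6 / 5 * a := by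
    have : (⌈a⌉₊ : ℝ) < a + 1 := Nat.ceil_lt_add_one ha0
    linarith
  constructor
  · rw [← ha2]; gcongr
  · calc (⌈a⌉₊ : ℝ) ^ 2 ≤ (6 / 5 * a) ^ 2 := by gcongr
      _ ≤ 47 * μ := by rw [mul_pow, ha2]; linarith

/-- The bound `log X ≤ 2√X` lets the logarithmic term of case (c) disappear into `X` as soon as `μ ≤
X`. -/
theorem sqrt_mul_log_le {μ X : ℝ} (hX : 1 ≤ X) (hμX : μ ≤ X) : √μ * Real.log X ≤ 2 * X := by
  have hX0 : 0 < X := by linarith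
  have h1 : Real.log X ≤ 2 * √X := by
    have := Real.log_le_sub_one_of_pos (Real.sqrt_pos.2 hX0)
    rw [Real.log_sqrt hX0.le] at this
    linarith
  calc √μ * Real.log X ≤ √X * (2 * √X) :=
        mul_le_mul (Real.sqrt_le_sqrt hμX) h1 (Real.log_nonneg hX) (Real.sqrt_nonneg _)
    _ = 2 * (√X * √X) := by ring
    _ = 2 * X := by rw [Real.mul_self_sqrt hX0.le]

theorem linBound_le {D Q : ℝ} (hQ : 0 < Q) (N : ℕ) :
    (linBound D Q N : ℝ) ≤ 9 * N * D ^ 2 / Q + 3 := by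
  rw [linBound]
  push_cast
  gcongr
  exact Nat.floor_le (by positivity)

end Numerics

/-! ### The three parameter choices -/

section Main

variable {d n : ℕ} {L D : ℝ} {K : Set (Vec d)} {F : Fin n → Vec d → ℝ} {lmo : Vec d → Vec d}
  {ws x₀ : Vec d} {Dsq : ℕ → ℝ} {N : ℕ → ℕ} {m : ℕ → ℕ → ℕ}
  {S : Type*} [MeasurableSpace S] {P : Measure S} [IsProbabilityMeasure P]
  {ξ : ℕ × ℕ × ℕ → S → Fin n}

theorem Problem.achieves (h : Problem L D K F lmo ws) (hξ : UniformSamples P ξ)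
    (hQ : ∀ t, 0 < Dsq t) (hN : ∀ t, 0 < N t) {T : ℕ} {ε a b c : ℝ}
    (hacc : mean P ξ (fun ω => avg F (runAt (mkParams L Dsq N m) K F lmo x₀ T ω).w - avg F ws)
      ≤ ε)
    (ha : (T : ℝ) + 1 ≤ a)
    (hb : 1 + ∑ t ∈ Finset.range T,
      (N (t + 1) : ℝ) * (9 * N (t + 1) * D ^ 2 / Dsq (t + 1) + 3) ≤ b)
    (hc : ∑ t ∈ Finset.range T, ∑ j ∈ Finset.range (N (t + 1)), 2 * (m (t + 1) (j + 1) : ℝ) ≤ c) :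
    Achieves P K (avg F) ws ε (randomRun (mkParams L Dsq N m) K F lmo x₀ ξ T) a b c := by
  refine ⟨⟨fun ω => h.run_mem _ _ _, ?_, hacc⟩, fun ω => ⟨?_, ?_, ?_⟩⟩
  · exact ((finDep_runAt (mkParams L Dsq N m) K F lmo x₀ T).comp fun s =>
      avg F s.w - avg F ws).integrable hξ
  · rw [randomRun, run_exact]
    push_cast
    exact ha
  · have h1 := h.run_lin_le (m := m) hQ hN x₀ (fun t k j => ξ (t, k, j) ω) T
    have h2 : ((1 + ∑ t ∈ Finset.range T,
        N (t + 1) * linBound D (Dsq (t + 1)) (N (t + 1)) : ℕ) : ℝ) ≤ b := by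
      push_cast
      refine le_trans ?_ hb
      gcongr with t
      exact linBound_le (hQ _) _
    calc (((randomRun (mkParams L Dsq N m) K F lmo x₀ ξ T ω).lin : ℕ∞) : ℝ≥0∞)
        ≤ (((1 + ∑ t ∈ Finset.range T,
          N (t + 1) * linBound D (Dsq (t + 1)) (N (t + 1)) : ℕ) : ℕ∞) : ℝ≥0∞) := by
          exact_mod_cast h1
      _ = ENNReal.ofReal ((1 + ∑ t ∈ Finset.range T,
          N (t + 1) * linBound D (Dsq (t + 1)) (N (t + 1)) : ℕ) : ℝ) := by
          rw [ENNReal.ofReal_natCast, ENat.toENNReal_coe]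
      _ ≤ ENNReal.ofReal b := ENNReal.ofReal_le_ofReal h2
  · rw [randomRun, run_stoch]
    push_cast
    exact hc

/-- All distances are bounded by `D`, so `B = D²` and `b = 0`. With `N_t² ≤ 25 · 2^t` the batch
requirement is `3N_t(36 + 2 · 25) = 258 N_t`, below `700 N_t`. -/
theorem Problem.mean_gap_le_growing (h : Problem L D K F lmo ws) (hD : 0 < D)
    (hξ : UniformSamples P ξ) (hx₀ : x₀ ∈ K) (hm : ∀ t k, 700 * (growingN t : ℝ) ≤ m t k) (t : ℕ) :
    mean P ξ (fun ω =>
        avg F (runAt (mkParams L (fun _ => D ^ 2) growingN m) K F lmo x₀ t ω).w - avg F ws)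
      ≤ L * D ^ 2 / 2 ^ (t + 1) := by
  have hL := h.L_pos
  have hdist : ∀ x ∈ K, ∀ y ∈ K, ‖x - y‖ ^ 2 ≤ D ^ 2 := fun x hx y hy => by
    have := h.norm_sub_le x hx y hy
    gcongr
  refine h.mean_gap_le hξ hx₀ (B := D ^ 2) (b := 0) (q₀ := D ^ 2) (q₁ := 0) (fun _ => by positivity)
    growingN_pos le_rfl (fun t k => ?_) le_rfl (fun w hw => ?_) (fun t => by simp)
    (fun x hx y hy => ?_) (fun t k => ?_) (fun t => ?_) t
  · have h1 := hm t k
    have h2 : (0 : ℝ) < growingN t := by exact_mod_cast growingN_pos t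
    exact_mod_cast (by linarith : (0 : ℝ) < m t k)
  · simpa using hdist w hw ws h.mem
  · simpa using hdist x hx y hy
  · have h1 := hm (t + 1) (k + 1)
    have h2 := (growingN_sq (t + 1)).2
    have h3 : (growingN (t + 1) : ℝ) ^ 2 / 2 ^ (t + 1) ≤ 25 := by
      rwa [div_le_iff₀ (by positivity)]
    have e : 3 * (growingN (t + 1) : ℝ) * (4 * L ^ 2 * (D ^ 2 + 0 * (8 * L * D ^ 2))
        + 32 * L ^ 2 * D ^ 2 + 2 * L * (L * D ^ 2 / 2 ^ (t + 1)) * growingN (t + 1) ^ 2)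
        = 3 * (growingN (t + 1) : ℝ) * (36 + 2 * (growingN (t + 1) ^ 2 / 2 ^ (t + 1)))
          * (L ^ 2 * D ^ 2) := by ring
    rw [e]
    refine mul_le_mul_of_nonneg_right (le_trans ?_ h1) (by positivity)
    have h4 : (0 : ℝ) ≤ growingN (t + 1) := by positivity
    nlinarith
  · have h1 := (growingN_sq (t + 1)).1
    have h2 : 16 * 2 ^ (t + 1) * (L * D ^ 2 / 2 ^ (t + 2))
        ≤ (growingN (t + 1) : ℝ) ^ 2 * (L * D ^ 2 / 2 ^ (t + 2)) := by gcongr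
    refine le_trans (le_of_eq ?_) h2
    field_simp
    ring

theorem one_add_sum_lin_growing_le (hD : 0 < D) {T : ℕ} {X : ℝ} (hT : (2 : ℝ) ^ T ≤ 2 * X) :
    1 + ∑ t ∈ Finset.range T,
      (growingN (t + 1) : ℝ) * (9 * growingN (t + 1) * D ^ 2 / D ^ 2 + 3) ≤ 1202 * X := by
  have h1 : ∑ t ∈ Finset.range T,
      (growingN (t + 1) : ℝ) * (9 * growingN (t + 1) * D ^ 2 / D ^ 2 + 3)
      ≤ ∑ t ∈ Finset.range T, 300 * (2 : ℝ) ^ (t + 1) := by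
    refine Finset.sum_le_sum fun t _ => ?_
    have h2 := (growingN_sq (t + 1)).2
    have h3 : (1 : ℝ) ≤ growingN (t + 1) := by exact_mod_cast growingN_pos (t + 1)
    rw [mul_div_assoc, div_self (by positivity), mul_one]
    nlinarith
  rw [← Finset.mul_sum] at h1
  have h2 := sum_pow_succ_le (le_refl (2 : ℝ)) T
  have h3 : (1 : ℝ) ≤ 2 ^ T := one_le_pow₀ (by norm_num)
  linarith

theorem Problem.achieves_minimizer_params (h : Problem L D K F lmo ws) (hD : 0 < D)
    (hξ : UniformSamples P ξ) (hx₀ : x₀ ∈ K) {T : ℕ} {ε a X : ℝ}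
    (hacc : L * D ^ 2 / 2 ^ (T + 1) ≤ ε) (ha : (T : ℝ) + 1 ≤ a) (hT : (2 : ℝ) ^ T ≤ 2 * X) :
    Achieves P K (avg F) ws ε (randomRun (paramsA L D) K F lmo x₀ ξ T) a (1202 * X)
      (180000 * X) := by
  refine h.achieves hξ (fun _ => by positivity) growingN_pos
    ((h.mean_gap_le_growing hD hξ hx₀ (fun t k => ?_) T).trans hacc) ha
    (one_add_sum_lin_growing_le hD hT) ?_
  · push_cast
    gcongr
    norm_num
  · have h1 : ∑ t ∈ Finset.range T, ∑ _j ∈ Finset.range (growingN (t + 1)),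
        2 * ((900 * growingN (t + 1) : ℕ) : ℝ)
        ≤ ∑ t ∈ Finset.range T, 45000 * (2 : ℝ) ^ (t + 1) := by
      refine Finset.sum_le_sum fun t _ => ?_
      rw [Finset.sum_const, Finset.card_range, nsmul_eq_mul]
      push_cast
      have h2 := (growingN_sq (t + 1)).2
      nlinarith
    rw [← Finset.mul_sum] at h1
    have h2 := sum_pow_succ_le (le_refl (2 : ℝ)) T
    linarith

theorem Problem.achieves_lipschitz_params (h : Problem L D K F lmo ws) (hD : 0 < D)
    (hξ : UniformSamples P ξ) (hx₀ : x₀ ∈ K) {T : ℕ} {ε a X G : ℝ} (hG : 0 ≤ G) (hX : 0 ≤ X)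
    (hacc : L * D ^ 2 / 2 ^ (T + 1) ≤ ε) (ha : (T : ℝ) + 1 ≤ a) (hT : (2 : ℝ) ^ T ≤ 2 * X) :
    Achieves P K (avg F) ws ε (randomRun (paramsB L D G) K F lmo x₀ ξ T) a (1202 * X)
      (140200 * X + 72000 * (X * √X * (G / (L * D)))) := by
  have hL := h.L_pos
  have hg : 0 ≤ G / (L * D) := by positivity
  refine h.achieves hξ (fun _ => by positivity) growingN_pos
    ((h.mean_gap_le_growing hD hξ hx₀ (fun t k => ?_) T).trans hacc) ha
    (one_add_sum_lin_growing_le hD hT) ?_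
  · refine le_trans ?_ (Nat.le_ceil _)
    have : 0 ≤ 24 * (growingN t : ℝ) * G * ((k : ℝ) + 1) / (L * D) := by positivity
    linarith
  · have h1 : ∀ t ∈ Finset.range T, ∑ j ∈ Finset.range (growingN (t + 1)),
        2 * ((⌈700 * (growingN (t + 1) : ℝ)
          + 24 * (growingN (t + 1) : ℝ) * G * (((j + 1 : ℕ) : ℝ) + 1) / (L * D)⌉₊ : ℕ) : ℝ)
        ≤ 35050 * (2 : ℝ) ^ (t + 1) + 12000 * (G / (L * D)) * √8 ^ (t + 1) := fun t _ => by
      -- Per round, `1402 · 25 = 35050` and `96 · 125 = 12000`, where the ceiling is absorbed by `M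
      -- ≥ 1`.
      set M : ℝ := (growingN (t + 1) : ℝ) with hM
      have hM1 : 1 ≤ M := by rw [hM]; exact_mod_cast growingN_pos (t + 1)
      have h2 : M ^ 2 ≤ 25 * 2 ^ (t + 1) := (growingN_sq (t + 1)).2
      have h3 : M ^ 3 ≤ 125 * √8 ^ (t + 1) := growingN_cube_le (t + 1)
      have h4 : ∀ j ∈ Finset.range (growingN (t + 1)),
          2 * ((⌈700 * M + 24 * M * G * (((j + 1 : ℕ) : ℝ) + 1) / (L * D)⌉₊ : ℕ) : ℝ)
          ≤ 1402 * M + 96 * M ^ 2 * (G / (L * D)) := fun j hj => by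
        have hj' : ((j + 1 : ℕ) : ℝ) ≤ M := by
          rw [hM]; exact_mod_cast Finset.mem_range.1 hj
        have h5 := Nat.ceil_lt_add_one
          (show 0 ≤ 700 * M + 24 * M * G * (((j + 1 : ℕ) : ℝ) + 1) / (L * D) by positivity)
        have h6 : 24 * M * G * (((j + 1 : ℕ) : ℝ) + 1) / (L * D)
            ≤ 48 * M ^ 2 * (G / (L * D)) := by
          have e : 24 * M * G * (((j + 1 : ℕ) : ℝ) + 1) / (L * D)
              = 24 * M * (((j + 1 : ℕ) : ℝ) + 1) * (G / (L * D)) := by ring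
          rw [e]
          refine mul_le_mul_of_nonneg_right ?_ hg
          nlinarith
        linarith
      refine (Finset.sum_le_sum h4).trans ?_
      rw [Finset.sum_const, Finset.card_range, nsmul_eq_mul, ← hM]
      have h7 := mul_le_mul_of_nonneg_right h3 hg
      nlinarith
    refine (Finset.sum_le_sum h1).trans ?_
    rw [Finset.sum_add_distrib, ← Finset.mul_sum, ← Finset.mul_sum]
    have h2 := sum_pow_succ_le (le_refl (2 : ℝ)) T
    have h8 : (2 : ℝ) ≤ √8 := Real.le_sqrt_of_sq_le (by norm_num)
    have h3 := (sum_pow_succ_le h8 T).trans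
      (mul_le_mul_of_nonneg_left (sqrt_eight_pow_le hX hT) (by norm_num))
    have h4 := mul_le_mul_of_nonneg_left h3 (show 0 ≤ 12000 * (G / (L * D)) by positivity)
    linarith

/-- Strong convexity and smoothness are compared at two distinct points of `K`, which exist because
the diameter is positive. This yields `μ ≥ 1`. -/
theorem Problem.strongConvexity_le (h : Problem L D K F lmo ws) (hD : 0 < D) {α : ℝ}
    (hdiam : Metric.diam K = D) (hsc : StronglyConvexOn α K (avg F)) : α ≤ L := by
  have hnt : K.Nontrivial := by
    by_contra hK
    rw [Set.not_nontrivial_iff] at hK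
    rw [Metric.diam_subsingleton hK] at hdiam
    exact hD.ne hdiam
  obtain ⟨w, hw, v, hv, hne⟩ := hnt
  have h1 := hsc w hw v hv
  have h2 := (avg_convexSmooth h.n_pos h.smooth).upper v w
  have h3 : 0 < ‖w - v‖ ^ 2 := by
    have := norm_pos_iff.2 (sub_ne_zero.2 hne)
    positivity
  rw [← neg_sub w v, inner_neg_right, norm_neg] at h2
  have h4 : α / 2 * ‖w - v‖ ^ 2 ≤ L / 2 * ‖w - v‖ ^ 2 := by linarith
  have := le_of_mul_le_mul_right h4 h3
  linarith

theorem Problem.norm_sub_sq_le_of_stronglyConvexOn (h : Problem L D K F lmo ws) {α : ℝ}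
    (hα : 0 < α) (hsc : StronglyConvexOn α K (avg F)) {w : Vec d} (hw : w ∈ K) :
    ‖w - ws‖ ^ 2 ≤ 2 / α * (avg F w - avg F ws) := by
  have h1 := hsc ws h.mem w hw
  have h2 := (avg_convexSmooth h.n_pos h.smooth).inner_gradient_nonneg_of_isMinOn h.convex h.mem
    h.isMin hw
  rw [← neg_sub w ws, inner_neg_right, norm_neg] at h1
  rw [div_mul_eq_mul_div, le_div_iff₀ hα]
  linarith

/-- Strong convexity turns the gap bound into `E‖w_t - w*‖² ≤ (2/α) L D²/2^(t+1) = D_{t+1}²`, so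
`D_t²` shrinks and `N_t` can stay constant. It also bounds `‖x-y‖²` by `2/α` times the potential,
hence `B = 0`, `b = 2/α`. -/
theorem Problem.mean_gap_le_stronglyConvex (h : Problem L D K F lmo ws) (hD : 0 < D)
    (hξ : UniformSamples P ξ) (hx₀ : x₀ ∈ K) {α : ℝ} (hα : 0 < α) (hαL : α ≤ L)
    (hsc : StronglyConvexOn α K (avg F)) (t : ℕ) :
    mean P ξ (fun ω => avg F (runAt (paramsC L D (L / α)) K F lmo x₀ t ω).w - avg F ws)
      ≤ L * D ^ 2 / 2 ^ (t + 1) := by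
  have hL := h.L_pos
  set μ := L / α with hμ
  have hμ1 : 1 ≤ μ := by rwa [hμ, one_le_div hα]
  have hμ0 : 0 < μ := by linarith
  have hLμ : L = α * μ := by rw [hμ]; field_simp
  have hpow : ∀ t : ℕ, (2 : ℝ) ^ (((t + 1 : ℕ) : ℤ) - 1) = 2 ^ t := fun t => by
    rw [Nat.cast_add, Nat.cast_one, add_sub_cancel_right, zpow_natCast]
  have hN := ceil_sqrt_sq hμ1
  set M := ⌈√(32 * μ)⌉₊ with hM
  have hMpos : 0 < M := Nat.ceil_pos.2 (by positivity)
  have hM0 : (0 : ℝ) < M := by exact_mod_cast hMpos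
  have hdist := fun w hw => h.norm_sub_sq_le_of_stronglyConvexOn hα hsc (w := w) hw
  refine h.mean_gap_le hξ hx₀ (B := 0) (b := 2 / α) (q₀ := 0) (q₁ := 2 / α)
    (fun _ => by positivity) (fun _ => hMpos) (by positivity)
    (fun t k => Nat.ceil_pos.2 (by positivity)) (by positivity)
    (fun w hw => by simpa using hdist w hw) (fun t => ?_) (fun x hx y hy => ?_)
    (fun t k => ?_) (fun t => ?_) t
  · simp only [hpow]
    refine le_of_eq ?_
    rw [hμ, pow_succ]
    field_simp
    ring
  · have h1 : ‖x - y‖ ^ 2 ≤ 2 * ‖x - ws‖ ^ 2 + 2 * ‖y - ws‖ ^ 2 := by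
      have e : x - y = (x - ws) - (y - ws) := by abel
      have h2 := parallelogram_law_with_norm ℝ (x - ws) (y - ws)
      rw [e]
      nlinarith [sq_nonneg ‖x - ws + (y - ws)‖]
    have h2 := hdist y hy
    have h3 : 2 * ‖x - ws‖ ^ 2 ≤ 2 / α * (3 * L * ‖x - ws‖ ^ 2) := by
      have e : 2 / α * (3 * L * ‖x - ws‖ ^ 2) = 6 * μ * ‖x - ws‖ ^ 2 := by
        rw [hμ]; field_simp; ring
      rw [e]
      gcongr
      linarith
    linarith
  · simp only [hpow]
    have hm : 5600 * (M : ℝ) * μ ≤ (⌈5600 * (M : ℝ) * μ⌉₊ : ℝ) := Nat.le_ceil _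
    have e : 3 * (M : ℝ) * (4 * L ^ 2 * (0 + 2 / α * (8 * L * (μ * D ^ 2 / 2 ^ t)))
        + 32 * L ^ 2 * (μ * D ^ 2 / 2 ^ t) + 2 * L * (L * D ^ 2 / 2 ^ (t + 1)) * (M : ℝ) ^ 2)
        = 3 * (M : ℝ) * (64 * μ + 32 + (M : ℝ) ^ 2 / μ) * (L ^ 2 * (μ * D ^ 2 / 2 ^ t)) := by
      rw [pow_succ, hLμ]
      field_simp
      ring
    rw [e]
    refine mul_le_mul_of_nonneg_right (le_trans ?_ hm) (by positivity)
    have h1 : (M : ℝ) ^ 2 / μ ≤ 47 := by rw [div_le_iff₀ hμ0]; exact hN.2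
    have h2 : 3 * (M : ℝ) * (64 * μ + 32 + (M : ℝ) ^ 2 / μ) ≤ 3 * (M : ℝ) * (1000 * μ) := by
      gcongr
      linarith
    have h3 : 0 ≤ (M : ℝ) * μ := by positivity
    linarith
  · simp only [hpow]
    have h1 : 32 * μ * (L * D ^ 2 / 2 ^ (t + 2)) ≤ (M : ℝ) ^ 2 * (L * D ^ 2 / 2 ^ (t + 2)) := by
      gcongr
      exact hN.1
    refine le_trans (le_of_eq ?_) h1
    rw [pow_add]
    field_simp
    ring

theorem Problem.achieves_stronglyConvex_params (h : Problem L D K F lmo ws) (hD : 0 < D)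
    (hξ : UniformSamples P ξ) (hx₀ : x₀ ∈ K) {α : ℝ} (hα : 0 < α) (hαL : α ≤ L)
    (hsc : StronglyConvexOn α K (avg F)) {T : ℕ} {ε a b c : ℝ}
    (hacc : L * D ^ 2 / 2 ^ (T + 1) ≤ ε) (ha : (T : ℝ) + 1 ≤ a)
    (hb : 424 * 2 ^ T + 21 * √(L / α) * T ≤ b) (hc : 530000 * (L / α) ^ 2 * T ≤ c) :
    Achieves P K (avg F) ws ε (randomRun (paramsC L D (L / α)) K F lmo x₀ ξ T) a b c := by
  have hL := h.L_pos
  have hgap := h.mean_gap_le_stronglyConvex (P := P) hD hξ hx₀ hα hαL hsc T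
  set μ := L / α with hμ
  have hμ1 : 1 ≤ μ := by rwa [hμ, one_le_div hα]
  have hμ0 : 0 < μ := by linarith
  have hpow : ∀ t : ℕ, (2 : ℝ) ^ (((t + 1 : ℕ) : ℤ) - 1) = 2 ^ t := fun t => by
    rw [Nat.cast_add, Nat.cast_one, add_sub_cancel_right, zpow_natCast]
  have hN := ceil_sqrt_sq hμ1
  have hMpos : 0 < ⌈√(32 * μ)⌉₊ := Nat.ceil_pos.2 (by positivity)
  refine h.achieves hξ (fun _ => by positivity) (fun _ => hMpos) (hgap.trans hacc) ha
    (le_trans ?_ hb) (le_trans ?_ hc)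
  · simp only [hpow]
    set M : ℝ := (⌈√(32 * μ)⌉₊ : ℝ) with hM
    have hM0 : 0 < M := by rw [hM]; exact_mod_cast hMpos
    have hM7 : M ≤ 7 * √μ := by
      refine le_of_sq_le_sq ?_ (by positivity)
      rw [mul_pow, Real.sq_sqrt hμ0.le]
      linarith [hN.2]
    have hM2 : M ^ 2 / μ ≤ 47 := by rw [div_le_iff₀ hμ0]; exact hN.2
    -- Here `423 = 9 · 47` and `21 = 3 · 7`, from `M² ≤ 47μ` and `M ≤ 7√μ`.
    have h1 : ∀ t ∈ Finset.range T, M * (9 * M * D ^ 2 / (μ * D ^ 2 / 2 ^ t) + 3)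
        ≤ 423 * 2 ^ t + 21 * √μ := fun t _ => by
      have e : M * (9 * M * D ^ 2 / (μ * D ^ 2 / 2 ^ t) + 3)
          = 9 * (M ^ 2 / μ) * 2 ^ t + 3 * M := by field_simp
      have h2 : 9 * (M ^ 2 / μ) * 2 ^ t ≤ 9 * 47 * (2 : ℝ) ^ t := by gcongr
      rw [e]
      linarith
    have h2 := Finset.sum_le_sum h1
    rw [Finset.sum_add_distrib, ← Finset.mul_sum _ _ (423 : ℝ), Finset.sum_const,
      Finset.card_range, nsmul_eq_mul] at h2
    have h3 : ∑ t ∈ Finset.range T, (2 : ℝ) ^ t ≤ 2 ^ T := by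
      have := geom_sum_eq (show (2 : ℝ) ≠ 1 by norm_num) T
      rw [this]
      norm_num
    have h4 : (1 : ℝ) ≤ 2 ^ T := one_le_pow₀ (by norm_num)
    linarith
  · simp only [Finset.sum_const, Finset.card_range, nsmul_eq_mul]
    have hceil := Nat.ceil_lt_add_one
      (show 0 ≤ 5600 * (⌈√(32 * μ)⌉₊ : ℝ) * μ by positivity)
    set M : ℝ := (⌈√(32 * μ)⌉₊ : ℝ) with hM
    have hM1 : 1 ≤ M := by rw [hM]; exact_mod_cast hMpos
    have h1 : M * (2 * (⌈5600 * M * μ⌉₊ : ℝ)) ≤ 530000 * μ ^ 2 := by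
      have h2 : 1 ≤ M * μ := one_le_mul_of_one_le_of_one_le hM1 hμ1
      have h3 : M * (2 * (⌈5600 * M * μ⌉₊ : ℝ)) ≤ M * (2 * (5601 * (M * μ))) := by
        gcongr
        linarith
      have h4 : M ^ 2 * μ ≤ 47 * μ * μ := mul_le_mul_of_nonneg_right hN.2 hμ0.le
      nlinarith
    have := mul_le_mul_of_nonneg_left h1 (Nat.cast_nonneg (α := ℝ) T)
    linarith

theorem sqrt_mul_div_rpow_eq {ε G : ℝ} (hL : 0 < L) (hD : 0 < D) (hε : 0 < ε) :
    (L * D ^ 2 / ε) * √(L * D ^ 2 / ε) * (G / (L * D))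
      = √L * D ^ 2 * G / ε ^ (3 / 2 : ℝ) := by
  have h1 : ε ^ (3 / 2 : ℝ) = ε * √ε := by
    rw [show (3 / 2 : ℝ) = 1 + 1 / 2 by norm_num, Real.rpow_add hε, Real.rpow_one,
      Real.sqrt_eq_rpow]
  have h2 : √(L * D ^ 2 / ε) = √L * D / √ε := by
    rw [Real.sqrt_div' _ hε.le, Real.sqrt_mul hL.le, Real.sqrt_sq hD.le]
  rw [h1, h2]
  field_simp

end Main

end STORC

theorem mainTheorem4 :
    ∃ C : ℝ, 0 < C ∧
    ∀ L D ε : ℝ, 0 < ε → ε ≤ L * D ^ 2 / 2 →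
    ∃ T : ℕ,
    ∀ (d n : ℕ) (K : Set (STORC.Vec d)) (F : Fin n → STORC.Vec d → ℝ)
      (lmo : STORC.Vec d → STORC.Vec d) (x₀ wstar : STORC.Vec d)
      (S : Type*) [MeasurableSpace S] (P : Measure S) [IsProbabilityMeasure P]
      (ξ : ℕ × ℕ × ℕ → S → Fin n),
      0 < n →
      IsCompact K → Convex ℝ K → Metric.diam K = D →
      (∀ i, STORC.ConvexSmooth L (F i)) →
      STORC.IsLMO K lmo → x₀ ∈ K →
      wstar ∈ K → IsMinOn (STORC.avg F) K wstar →
      STORC.UniformSamples P ξ →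
      -- case (a)
      (gradient (STORC.avg F) wstar = 0 →
        STORC.Achieves P K (STORC.avg F) wstar ε
          (STORC.randomRun (STORC.paramsA L D) K F lmo x₀ ξ T)
          (C * Real.log (L * D ^ 2 / ε))
          (C * (L * D ^ 2 / ε))
          (C * (L * D ^ 2 / ε))) ∧
      -- case (b)
      (∀ G : ℝ, STORC.GradBoundedOn G K (STORC.avg F) →
        STORC.Achieves P K (STORC.avg F) wstar ε
          (STORC.randomRun (STORC.paramsB L D G) K F lmo x₀ ξ T)
          (C * Real.log (L * D ^ 2 / ε))
          (C * (L * D ^ 2 / ε))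
          (C * (L * D ^ 2 / ε + √L * D ^ 2 * G / ε ^ (3 / 2 : ℝ)))) ∧
      -- case (c), with `μ = L / α`
      (∀ α : ℝ, 0 < α → STORC.StronglyConvexOn α K (STORC.avg F) →
        STORC.Achieves P K (STORC.avg F) wstar ε
          (STORC.randomRun (STORC.paramsC L D (L / α)) K F lmo x₀ ξ T)
          (C * Real.log (L * D ^ 2 / ε))
          (C * (L * D ^ 2 / ε + √(L / α) * Real.log (L * D ^ 2 / ε)))
          (C * ((L / α) ^ 2 * Real.log (L * D ^ 2 / ε))) ∧
        (ε ≤ α * D ^ 2 →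
          STORC.Achieves P K (STORC.avg F) wstar ε
            (STORC.randomRun (STORC.paramsC L D (L / α)) K F lmo x₀ ξ T)
            (C * Real.log (L * D ^ 2 / ε))
            (C * (L * D ^ 2 / ε))
            (C * ((L / α) ^ 2 * Real.log (L * D ^ 2 / ε))))) := by

  -- The largest demand is the stochastic cost of case (c), `530000 · 6` times `μ² log X`.
  refine ⟨4000000, by norm_num, fun L D ε hε hεL => ?_⟩
  have hX2 : 2 ≤ L * D ^ 2 / ε := by rw [le_div_iff₀ hε]; linarith
  obtain ⟨T, hXT, hTX, hTlog⟩ := STORC.exists_rounds hX2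
  refine ⟨T, fun d n K F lmo x₀ wstar S _ P _ ξ hn hKc hK hdiam hF hlmo hx₀ hws hmin hξ => ?_⟩
  have hLD : 0 < L * D ^ 2 := by linarith
  have hD0 : 0 ≤ D := hdiam ▸ Metric.diam_nonneg
  have hD : 0 < D := lt_of_le_of_ne hD0 fun h => by rw [← h] at hLD; simp at hLD
  have hL : 0 < L := pos_of_mul_pos_left hLD (by positivity)
  have hprob : STORC.Problem L D K F lmo wstar :=
    ⟨hL, hn, hKc, hK, fun x hx y hy => by
      rw [← dist_eq_norm, ← hdiam]
      exact Metric.dist_le_diam_of_mem hKc.isBounded hx hy, hF, hlmo, hws, hmin⟩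
  have hacc : L * D ^ 2 / 2 ^ (T + 1) ≤ ε := by
    rw [div_le_iff₀ hε] at hXT
    rw [div_le_iff₀ (by positivity), pow_succ 2]
    have : 0 ≤ ε * 2 ^ T := by positivity
    linarith
  set X := L * D ^ 2 / ε with hX
  have hlog : 0 ≤ Real.log X := Real.log_nonneg (by linarith)
  have ha : (T : ℝ) + 1 ≤ 4000000 * Real.log X := by linarith
  have mono : ∀ {r : S → STORC.Outer d} {a b c b' c' : ℝ}, b ≤ b' → c ≤ c' →
      STORC.Achieves P K (STORC.avg F) wstar ε r a b c →
      STORC.Achieves P K (STORC.avg F) wstar ε r a b' c' := fun hb hc h =>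
    ⟨h.1, fun ω => ⟨(h.2 ω).1, (h.2 ω).2.1.trans (ENNReal.ofReal_le_ofReal hb),
      (h.2 ω).2.2.trans hc⟩⟩
  refine ⟨fun _ => ?_, fun G hG => ?_, fun α hα hsc => ?_⟩
  · exact mono (by linarith) (by linarith)
      (hprob.achieves_minimizer_params hD hξ hx₀ hacc ha hTX)
  · have hG0 : 0 ≤ G := (norm_nonneg _).trans (hG wstar hws)
    refine mono (by linarith) ?_
      (hprob.achieves_lipschitz_params hD hξ hx₀ hG0 (by linarith) hacc ha hTX)
    rw [hX, STORC.sqrt_mul_div_rpow_eq hL hD hε, ← hX]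
    have : 0 ≤ √L * D ^ 2 * G / ε ^ (3 / 2 : ℝ) := by positivity
    linarith
  · have hαL := hprob.strongConvexity_le hD hdiam hsc
    have hs : √(L / α) * T ≤ 6 * (√(L / α) * Real.log X) := by
      have := mul_le_mul_of_nonneg_left hTlog (Real.sqrt_nonneg (L / α))
      have := Real.sqrt_nonneg (L / α)
      linarith
    have hc : 530000 * (L / α) ^ 2 * T ≤ 4000000 * ((L / α) ^ 2 * Real.log X) := by
      have h1 := mul_le_mul_of_nonneg_left hTlog (sq_nonneg (L / α))
      have h2 := mul_nonneg (sq_nonneg (L / α)) hlog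
      have := sq_nonneg (L / α)
      linarith
    have hsl : 0 ≤ √(L / α) * Real.log X := by positivity
    refine ⟨hprob.achieves_stronglyConvex_params hD hξ hx₀ hα hαL hsc hacc ha ?_ hc, fun hεα =>
      hprob.achieves_stronglyConvex_params hD hξ hx₀ hα hαL hsc hacc ha ?_ hc⟩
    · linarith
    -- The condition `ε ≤ αD²` says precisely that `μ ≤ LD²/ε`.
    · have hμX : L / α ≤ X := by
        rw [hX, div_le_div_iff₀ hα hε]
        have := mul_le_mul_of_nonneg_left hεα hL.le
        linarith
      have := STORC.sqrt_mul_log_le (by linarith) hμX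
      linarith
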